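/- **Setting.** Consider the vacuum Einstein equations in $3+1$ form with canonical positions $q=(\gamma_{ij},\alpha,\beta^i)$ (spatial metric $\gamma_{ij}$, positive definite, $\gamma=\det\gamma_{ij}$; lapse $\alpha>0$; shift $\beta^i$) and canonical momenta $p=(\pi^{ij},\sigma,\rho_i)$. For formulation parameters $C=(C_1,\dots,C_7)$, which may be real numbers or functions of $q$, let $$\mathcal H=\mathcal H_{\rm ADM}+\mathcal H_{\rm GHG}+\int d^3x\,(\Lambda\sigma+\Omega^i\rho_i),$$ where $\mathcal H_{\rm ADM}=\int(-\alpha\, C_{\rm Ham}+2\beta^iC_i)\sqrt\gamma\,d^3x$ with $C_{\rm Ham}=R+K^2-K_{ij}K^{ij}$, $C_i=D_j(K^{j}{}_{i}-\delta^{j}_{i}K)$ and $\pi^{ij}=\sqrt\gamma(K\gamma^{ij}-K^{ij})$, integrated by parts so that its density depends on $(q,\partial_iq,p)$ only, $$\mathcal H_{\rm GHG}=\int d^3x\Big[\beta^i\sigma\partial_i\alpha+\beta^i\rho_j\partial_i\beta^j+\alpha^2\rho_i\Gamma^i_{jk}\gamma^{jk}-\alpha\rho^i\partial_i\alpha+\tfrac1{8\sqrt\gamma}\big(-4\alpha^2\gamma_{ij}\pi^{ij}\sigma+\alpha^3\sigma^2-4\alpha^3\rho_i\rho_j\gamma^{ij}\big)\Big],$$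 $$\Lambda=-C_1\alpha^2\gamma^{-1/2}\gamma_{ij}\pi^{ij}+C_4\alpha^3\gamma^{-1/2}\sigma+C_7\big(\alpha D_i\beta^i-\tfrac12\alpha\gamma^{jk}\beta^i\partial_i\gamma_{jk}\big),$$ $$\Omega^i=C_2\alpha^2\Gamma^i_{jk}\gamma^{jk}+C_3\alpha^2\Gamma^k_{kj}\gamma^{ji}-C_5\alpha\gamma^{ij}\partial_j\alpha-C_6\gamma^{-1/2}\alpha^3\rho_j\gamma^{ij}.$$ Put $\lambda_V^2:=1+C_2$ and $2\lambda_\pm^2:=(2C_1+C_2+C_3-C_7+2)\pm(-2C_1+C_2+C_3+C_7)$ (these are names of real numbers, not assumed non-negative). The canonical equations $\partial_tq=\partial\mathcal H_D/\partial p$, $\partial_tp=-\partial\mathcal H_D/\partial q+\partial_i(\partial\mathcal H_D/\partial(\partial_iq))$ have the principal part $\partial_tq\simeq A_1^i\partial_iq+A_2p$, $\partial_tp\simeq B_1^{ij}\partial_i\partial_jq+B_2^i\partial_ip$, whose coefficients at a background point are the second derivatives of $\mathcal H_D$ with respect to $(\partial_iq,p)$. Such a system is called *symmetric hyperbolic*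 (at the background) if it has a first order reduction with variables $u=(d_i,p)$, $d_i=\partial_iq$ (obtained by adding arbitrary multiples of the auxiliary constraints $\partial_{[i}d_{j]}$ to the equations), with principal part $\partial_tu\simeq\mathbb A^p\partial_pu$, for which there is a symmetric positive definite $H$ with $H\mathbb A^p$ symmetric for every $p$. **Theorem.** Consider the family of formulations given by $$\lambda_V^2=\tfrac14(3\lambda_+^2+1),\quad C_4=\tfrac18(\lambda_-^2-1),\quad C_5=0,\quad C_6=\tfrac38(\lambda_+^2-1),\quad C_7=0.\tag{F}$$ 1. For every pair of real values of $\lambda_-^2,\lambda_+^2$ exactly one choice of the parameters $C_1,\dots,C_7$ satisfies (F), so (F) is a two-parameter family. 2. At every background, every formulation that satisfies (F) with $\lambda_-^2>0$ and $\lambda_+^2>0$ is symmetric hyperbolic. 3. Let $\mu_L,\mu_S$ be functions of the positions and choose the member of (F) with $$\lambda_-^2=\mu_L,\qquad\lambda_+^2=\frac{4\mu_S\gamma^{1/3}}{3\alpha^2}-\frac13 .$$ At every background this formulation is symmetric hyperbolic if and only if $\mu_L>0$ and $4\gamma^{1/3}\mu_S>\alpha^2$. In terms of the extrinsic curvature $K_{ij}$,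 where $\pi^{ij}=\sqrt\gamma(K\gamma^{ij}-K^{ij})$, and of $\Theta=\frac12\alpha\sigma/\sqrt\gamma$, $Z_i=-\alpha\rho_i/(2\sqrt\gamma)$, its lapse and shift obey the modified puncture gauge $$\partial_t\alpha=\beta^i\partial_i\alpha-\mu_L\alpha^2K+\tfrac12\mu_L\alpha^2\Theta,$$ $$\partial_t\beta^i=\beta^j\partial_j\beta^i+\mu_S\gamma^{1/3}\Gamma^i_{jk}\gamma^{jk}+\tfrac13(\mu_S\gamma^{1/3}-\alpha^2)\Gamma^k_{kj}\gamma^{ij}+2\mu_S\gamma^{1/3}Z^i-\alpha D^i\alpha .$$ -/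

import Mathlib

noncomputable section

namespace HamiltonianGR

/-! ### First order in time, second order in space systems and symmetric hyperbolicity -/

section Hyperbolicity

variable {V W : Type*} [AddCommGroup V] [Module ℝ V] [AddCommGroup W] [Module ℝ W]

/-- Principal part, at a fixed background, of a first order in time, second order in space system
`∂ₜ v = A₁ⁱ ∂ᵢ v + A₂ w + …`, `∂ₜ w = B₁ⁱʲ ∂ᵢ ∂ⱼ v + B₂ⁱ ∂ᵢ w + …` in three space dimensions. -/
structure SecondOrderSystem (V W : Type*) [AddCommGroup V] [Module ℝ V]
    [AddCommGroup W] [Module ℝ W] where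
  A₁ : Fin 3 → V →ₗ[ℝ] V
  A₂ : W →ₗ[ℝ] V
  B₁ : Fin 3 → Fin 3 → V →ₗ[ℝ] W
  B₂ : Fin 3 → W →ₗ[ℝ] W

/-- `∂ₜ U = 𝔸ᵖ ∂ₚ U` is symmetric hyperbolic: there is a positive definite symmetrizer `H`, i.e.
one with `H 𝔸ᵖ` symmetric for every `p`. (For real `𝔸ᵖ` the real part of a positive definite
hermitian symmetrizer is again a symmetrizer, so real forms suffice.) -/
def FirstOrderSymmetricHyperbolic {U : Type*} [AddCommGroup U] [Module ℝ U]
    (𝔸 : Fin 3 → U →ₗ[ℝ] U) : Prop :=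
  ∃ H : LinearMap.BilinForm ℝ U,
    (∀ x y, H x y = H y x) ∧ (∀ x, x ≠ 0 → 0 < H x x) ∧
      ∀ p x y, H x (𝔸 p y) = H (𝔸 p x) y

/-- `𝔸ᵖ` is the principal part of a first order reduction of the system `S`, with the variables
`U = (dᵢ, w)` where `dᵢ = ∂ᵢ v`. (The field `v` itself is evolved without spatial derivatives, so
it does not enter the principal part.) For `dᵢ = ∂ᵢ v`, so that `∂ₚ dᵢ = ∂ₚ ∂ᵢ v` is symmetric in
`p` and `i`, the reduction has to reproduce the principal parts of `∂ᵢ (∂ₜ v)` and of `∂ₜ w`.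
Thus arbitrary multiples of the auxiliary constraints `∂ₚ dᵢ - ∂ᵢ dₚ` may be added to all
equations, and nothing else. Here `vv p i` stands for `∂ₚ ∂ᵢ v`, and `ww p` for `∂ₚ w`. -/
def SecondOrderSystem.IsFirstOrderReduction (S : SecondOrderSystem V W)
    (𝔸 : Fin 3 → ((Fin 3 → V) × W) →ₗ[ℝ] ((Fin 3 → V) × W)) : Prop :=
  ∀ (vv : Fin 3 → Fin 3 → V) (ww : Fin 3 → W), (∀ p i, vv p i = vv i p) →
    ∑ p, 𝔸 p (vv p, ww p) =
      (fun i => (∑ j, S.A₁ j (vv i j)) + S.A₂ (ww i),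
        (∑ i, ∑ j, S.B₁ i j (vv i j)) + ∑ i, S.B₂ i (ww i))

/-- The system is symmetric hyperbolic: it has a reduction to first order that is symmetric
hyperbolic. -/
def SecondOrderSystem.IsSymmetricHyperbolic (S : SecondOrderSystem V W) : Prop :=
  ∃ 𝔸 : Fin 3 → ((Fin 3 → V) × W) →ₗ[ℝ] ((Fin 3 → V) × W),
    S.IsFirstOrderReduction 𝔸 ∧ FirstOrderSymmetricHyperbolic 𝔸

end Hyperbolicity

/-! ### Canonical variables and canonical equations -/

/-- Symmetric 2-tensors in three dimensions. -/
def SymTensor : Submodule ℝ (Fin 3 → Fin 3 → ℝ) where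
  carrier := {T | ∀ i j, T i j = T j i}
  add_mem' := fun ha hb i j => by
    simp only [Pi.add_apply]; rw [ha i j, hb i j]
  zero_mem' := fun _ _ => rfl
  smul_mem' := fun c _ ha i j => by
    simp only [Pi.smul_apply]; rw [ha i j]

/-- Values of the canonical positions `(γᵢⱼ, α, βⁱ)`. -/
abbrev Positions : Type := SymTensor × ℝ × (Fin 3 → ℝ)

/-- Values of the canonical momenta `(πⁱʲ, σ, ρᵢ)`. -/
abbrev Momenta : Type := SymTensor × ℝ × (Fin 3 → ℝ)

/-- Values of `u = (∂ᵢ q, p)`. -/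
abbrev Jet : Type := (Fin 3 → Positions) × Momenta

/-- A Hamiltonian density `𝓗_D(q, ∂ᵢ q, p)`. -/
abbrev Density : Type := Positions → Jet → ℝ

/-- The symmetrization of the tensor with a single entry `1` at `(i, j)`. -/
def symUnit (i j : Fin 3) : SymTensor :=
  ⟨fun k l => ((if k = i ∧ l = j then 1 else 0) + (if k = j ∧ l = i then 1 else 0)) / 2,
    fun k l => by
      show (_ + _ : ℝ) / 2 = (_ + _) / 2
      rw [add_comm]
      simp only [and_comm]⟩

/-- The vector that represents a linear form with respect to the pairing
`πⁱʲ γᵢⱼ + σ α + ρᵢ βⁱ` of momenta and positions. -/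
def gradient : ((SymTensor × ℝ × (Fin 3 → ℝ)) →L[ℝ] ℝ) →ₗ[ℝ] (SymTensor × ℝ × (Fin 3 → ℝ)) where
  toFun ℓ :=
    (⟨fun i j => ℓ (symUnit i j, 0, 0), fun i j => by
        have h : symUnit i j = symUnit j i := by
          apply Subtype.ext
          funext k l
          simp only [symUnit]
          rw [add_comm]
        show ℓ (symUnit i j, 0, 0) = ℓ (symUnit j i, 0, 0)
        rw [h]⟩,
      ℓ (0, 1, 0), fun k => ℓ (0, 0, Pi.single k 1))
  map_add' _ _ := rfl
  map_smul' _ _ := rfl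

/-- `gradient ℓ` does represent `ℓ`. -/
theorem gradient_spec (ℓ : (SymTensor × ℝ × (Fin 3 → ℝ)) →L[ℝ] ℝ)
    (x : SymTensor × ℝ × (Fin 3 → ℝ)) :
    ℓ x = ∑ i, ∑ j, (gradient ℓ).1.1 i j * x.1.1 i j + (gradient ℓ).2.1 * x.2.1 +
      ∑ k, (gradient ℓ).2.2 k * x.2.2 k := by
  obtain ⟨⟨T, hT⟩, a, b⟩ := x
  have h1 : ((⟨T, hT⟩, a, b) : SymTensor × ℝ × (Fin 3 → ℝ)) =
      ∑ i, ∑ j, T i j • ((symUnit i j, 0, 0) : SymTensor × ℝ × (Fin 3 → ℝ)) +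
        a • ((0, 1, 0) : SymTensor × ℝ × (Fin 3 → ℝ)) +
        ∑ k, b k • ((0, 0, Pi.single k 1) : SymTensor × ℝ × (Fin 3 → ℝ)) := by
    have hT' : ∀ i j, T i j = T j i := hT
    refine Prod.ext (Subtype.ext ?_) (Prod.ext ?_ ?_)
    · funext k l
      fin_cases k <;> fin_cases l <;>
        simp [Fin.sum_univ_three, symUnit, hT' 1 0, hT' 2 0, hT' 2 1] <;> ring
    · simp [Fin.sum_univ_three]
    · funext k
      fin_cases k <;> simp [Fin.sum_univ_three]
  conv_lhs => rw [h1]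
  simp only [map_add, map_sum, map_smul, smul_eq_mul, gradient, LinearMap.coe_mk, AddHom.coe_mk]
  simp only [mul_comm]

/-- The part of a differential with respect to `u = (∂ᵢ q, p)` that belongs to `p`:
it maps `d𝓗_D` to `∂𝓗_D/∂p`. -/
def momentumGradient : (Jet →L[ℝ] ℝ) →ₗ[ℝ] Positions where
  toFun ℓ := gradient (ℓ.comp (ContinuousLinearMap.inr ℝ (Fin 3 → Positions) Momenta))
  map_add' ℓ m := by rw [ContinuousLinearMap.add_comp, map_add]
  map_smul' c ℓ := by rw [ContinuousLinearMap.smul_comp, map_smul]; rfl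

/-- The part of a differential with respect to `u = (∂ᵢ q, p)` that belongs to `∂ᵢ q`:
it maps `d𝓗_D` to `∂𝓗_D/∂(∂ᵢ q)`. -/
def slopeGradient (i : Fin 3) : (Jet →L[ℝ] ℝ) →ₗ[ℝ] Momenta where
  toFun ℓ := gradient ((ℓ.comp (ContinuousLinearMap.inl ℝ (Fin 3 → Positions) Momenta)).comp
    (ContinuousLinearMap.single ℝ (fun _ : Fin 3 => Positions) i))
  map_add' ℓ m := by rw [ContinuousLinearMap.add_comp, ContinuousLinearMap.add_comp, map_add]
  map_smul' c ℓ := by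
    rw [ContinuousLinearMap.smul_comp, ContinuousLinearMap.smul_comp, map_smul]; rfl

/-- The right-hand side of the canonical equation `∂ₜ q = ∂𝓗_D/∂p`. -/
def positionRate (𝓗 : Density) (q : Positions) (u : Jet) : Positions :=
  momentumGradient (fderiv ℝ (𝓗 q) u)

/-- The second differential of `𝓗_D` with respect to `u = (∂ᵢ q, p)`, at `(q, u)`. -/
def hessian (𝓗 : Density) (q : Positions) (u : Jet) : Jet →ₗ[ℝ] (Jet →L[ℝ] ℝ) :=
  (fderiv ℝ (fun u' => fderiv ℝ (𝓗 q) u') u).toLinearMap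

/-- The principal part, at the background `(q, u)`, of the canonical equations of motion
`∂ₜ q = ∂𝓗_D/∂p`, `∂ₜ p = -∂𝓗_D/∂q + ∂ᵢ (∂𝓗_D/∂(∂ᵢ q))` of a density `𝓗_D(q, ∂ᵢ q, p)`:
`A₂ = M⁻¹ = ∂²𝓗_D/∂p∂p`, `A₁ʲ = Fʲ = ∂²𝓗_D/∂p∂(∂ⱼ q)`, `B₁ⁱʲ = ∂²𝓗_D/∂(∂ᵢ q)∂(∂ⱼ q)` and
`B₂ⁱ = ∂²𝓗_D/∂(∂ᵢ q)∂p`. -/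
def canonicalSystem (𝓗 : Density) (q : Positions) (u : Jet) :
    SecondOrderSystem Positions Momenta where
  A₁ j := momentumGradient ∘ₗ hessian 𝓗 q u ∘ₗ LinearMap.inl ℝ (Fin 3 → Positions) Momenta ∘ₗ
    LinearMap.single ℝ (fun _ : Fin 3 => Positions) j
  A₂ := momentumGradient ∘ₗ hessian 𝓗 q u ∘ₗ LinearMap.inr ℝ (Fin 3 → Positions) Momenta
  B₁ i j := slopeGradient i ∘ₗ hessian 𝓗 q u ∘ₗ LinearMap.inl ℝ (Fin 3 → Positions) Momenta ∘ₗ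
    LinearMap.single ℝ (fun _ : Fin 3 => Positions) j
  B₂ i := slopeGradient i ∘ₗ hessian 𝓗 q u ∘ₗ LinearMap.inr ℝ (Fin 3 → Positions) Momenta

/-! ### Geometry of a slice -/

/-- `γᵢⱼ` -/
def metric (q : Positions) : Matrix (Fin 3) (Fin 3) ℝ := Matrix.of fun i j => q.1.1 i j

/-- `γⁱʲ` -/
def invMetric (q : Positions) : Matrix (Fin 3) (Fin 3) ℝ := (metric q)⁻¹

/-- `γ = det γᵢⱼ` -/
def detMetric (q : Positions) : ℝ := (metric q).det

/-- `α` -/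
def lapse (q : Positions) : ℝ := q.2.1

/-- `βⁱ` -/
def shift (q : Positions) (i : Fin 3) : ℝ := q.2.2 i

/-- `∂ᵢ γⱼₖ` -/
def dMetric (u : Jet) (i j k : Fin 3) : ℝ := (u.1 i).1.1 j k

/-- `∂ᵢ α` -/
def dLapse (u : Jet) (i : Fin 3) : ℝ := (u.1 i).2.1

/-- `∂ᵢ βʲ` -/
def dShift (u : Jet) (i j : Fin 3) : ℝ := (u.1 i).2.2 j

/-- `πⁱʲ` -/
def momPi (u : Jet) (i j : Fin 3) : ℝ := u.2.1.1 i j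

/-- `σ` -/
def momSigma (u : Jet) : ℝ := u.2.2.1

/-- `ρᵢ` -/
def momRho (u : Jet) (i : Fin 3) : ℝ := u.2.2.2 i

/-- The spatial metric is a Riemannian metric and the lapse is positive. -/
def Admissible (q : Positions) : Prop := (metric q).PosDef ∧ 0 < lapse q

/-- The Christoffel symbol `Γᵏᵢⱼ`. -/
def christoffel (q : Positions) (u : Jet) (k i j : Fin 3) : ℝ :=
  1 / 2 * ∑ l, invMetric q k l * (dMetric u i j l + dMetric u j i l - dMetric u l i j)

/-- `Γⁱⱼₖ γʲᵏ` -/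
def christoffelTrace (q : Positions) (u : Jet) (i : Fin 3) : ℝ :=
  ∑ j, ∑ k, christoffel q u i j k * invMetric q j k

/-- `Γᵏₖⱼ γʲⁱ` -/
def christoffelContr (q : Positions) (u : Jet) (i : Fin 3) : ℝ :=
  ∑ j, ∑ k, christoffel q u k k j * invMetric q j i

/-- `γᵢⱼ πⁱʲ` -/
def tracePi (q : Positions) (u : Jet) : ℝ := ∑ i, ∑ j, metric q i j * momPi u i j

/-! ### The Hamiltonian formulations of general relativity -/

/-- The ADM Hamiltonian density `(-α C + 2 βⁱ Cᵢ) √γ` in canonical variables, up to the divergence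
terms that bring it to the form `𝓗_D(q, ∂ᵢ q, p)`. With `π = γᵢⱼ πⁱʲ`,
* `α (Kᵢⱼ Kⁱʲ - K²) √γ = α γ^(-1/2) (πᵢⱼ πⁱʲ - π² / 2)`,
* `√γ R = √γ γⁱʲ (Γᵏᵢₗ Γˡⱼₖ - Γᵏᵢⱼ Γˡₖₗ) + ∂ₖ (√γ (γⁱʲ Γᵏᵢⱼ - γᵏⁱ Γˡₗᵢ))`, so that `-α √γ R` is
  the sum of the second and the third term below and a divergence,
* `2 βⁱ Cᵢ √γ = -2 βᵢ Dⱼ πⁱʲ` equals `πⁱʲ (𝓛_β γ)ᵢⱼ`, the last term below, up to a divergence. -/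
def admDensity (q : Positions) (u : Jet) : ℝ :=
  lapse q / √(detMetric q) *
      ((∑ i, ∑ j, ∑ k, ∑ l, metric q i k * metric q j l * momPi u i j * momPi u k l) -
        1 / 2 * tracePi q u ^ 2)
    - lapse q * √(detMetric q) *
      (∑ i, ∑ j, invMetric q i j *
        ((∑ k, ∑ l, christoffel q u k i l * christoffel q u l j k) -
          ∑ k, ∑ l, christoffel q u k i j * christoffel q u l k l))
    + √(detMetric q) *
      (∑ k, (christoffelTrace q u k - christoffelContr q u k) * dLapse u k)
    + ∑ i, ∑ j, momPi u i j *
      (∑ k, (shift q k * dMetric u k i j + metric q k j * dShift u i k +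
        metric q i k * dShift u j k))

/-- The terms of the gauge part of Brown's generalized harmonic Hamiltonian that enter the
principal part of the equations of motion. -/
def ghgDensity (q : Positions) (u : Jet) : ℝ :=
  (∑ i, shift q i * momSigma u * dLapse u i)
    + (∑ i, ∑ j, shift q i * momRho u j * dShift u i j)
    + lapse q ^ 2 * (∑ i, momRho u i * christoffelTrace q u i)
    - lapse q * (∑ i, ∑ j, invMetric q i j * momRho u j * dLapse u i)
    + 1 / (8 * √(detMetric q)) *
      (-4 * lapse q ^ 2 * tracePi q u * momSigma u + lapse q ^ 3 * momSigma u ^ 2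
        - 4 * lapse q ^ 3 * ∑ i, ∑ j, momRho u i * momRho u j * invMetric q i j)

/-- The formulation parameters. -/
@[ext] structure Parameters where
  C₁ : ℝ
  C₂ : ℝ
  C₃ : ℝ
  C₄ : ℝ
  C₅ : ℝ
  C₆ : ℝ
  C₇ : ℝ

/-- The lapse gauge term `Λ`. -/
def gaugeLambda (C : Parameters) (q : Positions) (u : Jet) : ℝ :=
  -C.C₁ * lapse q ^ 2 * (√(detMetric q))⁻¹ * tracePi q u
    + C.C₄ * lapse q ^ 3 * (√(detMetric q))⁻¹ * momSigma u
    + C.C₇ *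
      (lapse q * (∑ i, (dShift u i i + ∑ k, christoffel q u i i k * shift q k))
        - 1 / 2 * lapse q * ∑ i, ∑ j, ∑ k, invMetric q j k * shift q i * dMetric u i j k)

/-- The shift gauge term `Ωⁱ`. -/
def gaugeOmega (C : Parameters) (q : Positions) (u : Jet) (i : Fin 3) : ℝ :=
  C.C₂ * lapse q ^ 2 * christoffelTrace q u i
    + C.C₃ * lapse q ^ 2 * christoffelContr q u i
    - C.C₅ * lapse q * (∑ j, invMetric q i j * dLapse u j)
    - C.C₆ * (√(detMetric q))⁻¹ * lapse q ^ 3 * (∑ j, momRho u j * invMetric q i j)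

/-- The density of `𝓗_ADM + 𝓗_GHG + ∫ (Λ σ + Ωⁱ ρᵢ)`. The formulation parameters may be functions
of the positions. -/
def grDensity (C : Positions → Parameters) : Density := fun q u =>
  admDensity q u + ghgDensity q u + gaugeLambda (C q) q u * momSigma u
    + ∑ i, gaugeOmega (C q) q u i * momRho u i

/-- `λ₊²` -/
def lamPlusSq (C : Parameters) : ℝ :=
  ((2 * C.C₁ + C.C₂ + C.C₃ - C.C₇ + 2) + (-2 * C.C₁ + C.C₂ + C.C₃ + C.C₇)) / 2

/-- `λ₋²` -/
def lamMinusSq (C : Parameters) : ℝ :=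
  ((2 * C.C₁ + C.C₂ + C.C₃ - C.C₇ + 2) - (-2 * C.C₁ + C.C₂ + C.C₃ + C.C₇)) / 2

/-- `λ_V²` -/
def lamVSq (C : Parameters) : ℝ := 1 + C.C₂

/-- The relations that define the two-parameter family. -/
def InFamily (C : Parameters) : Prop :=
  lamVSq C = (3 * lamPlusSq C + 1) / 4 ∧ C.C₄ = (lamMinusSq C - 1) / 8 ∧ C.C₅ = 0 ∧
    C.C₆ = 3 * (lamPlusSq C - 1) / 8 ∧ C.C₇ = 0

/-- The relations between the canonical momenta `(πⁱʲ, σ, ρᵢ)` contained in `u` and the variables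
`(Kᵢⱼ, Θ, Zᵢ)` of the Z4 formulation. -/
def IsZ4Variables (q : Positions) (u : Jet) (K : Fin 3 → Fin 3 → ℝ) (Θ : ℝ) (Z : Fin 3 → ℝ) :
    Prop :=
  (∀ i j, momPi u i j = √(detMetric q) *
    ((∑ k, ∑ l, invMetric q k l * K k l) * invMetric q i j -
      ∑ k, ∑ l, invMetric q i k * invMetric q j l * K k l)) ∧
  Θ = 1 / 2 * (lapse q * momSigma u / √(detMetric q)) ∧
  ∀ i, Z i = -(lapse q * momRho u i / (2 * √(detMetric q)))

end HamiltonianGR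

end

open HamiltonianGR

/-! At a fixed point $q$ the density is an exact quadratic form in $u=(\partial_i q,p)$, so its
hessian does not depend on $u$ and the principal part has constant coefficients. Hyperbolicity can
therefore be decided after a linear change of variables. Choose a frame with $\gamma=e^Te$, refer
all components to it, and scale lapse and shift by $\alpha^{-1}$ and the momenta by powers of
$\alpha$ and $s=\sqrt\gamma$. On the family (F) the density becomes $\alpha s$ times a fixed form
`modelForm L P`, with $L=\lambda_-^2$, $P=\lambda_+^2$, plus the advection term $\beta^i
p\,\partial_i q$ (`grDensity_frame`). The change of variables is canonical up to the factor $s$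
(`pair_frame`), so it carries the equations of motion to $\alpha$ times the model equations plus
advection (`frameMap_rate`).

Sufficiency: for $L,P>0$ the model system has an explicit energy $H$. The model equations exchange
the even variables $(\partial g,\partial a,\rho)$ and the odd variables $(\partial b,\pi,\sigma)$;
accordingly $H$ is a sum of an even and an odd block, and one bilinear flux pairing even with odd
serves both blocks (`symmetrizerEven_modelRate`, `symmetrizerOdd_modelRate`). Free constants in $H$
make it positive definite (`symmetrizer_pos`). The reduction is then recovered as $\mathbb
A^p=H^{-1}T^p$, where $T^p$ is the symmetrized flux (`isSymmetricHyperbolic_of_hasSymmetrizer`).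

Necessity: two plane-wave subspaces, each spanned by a vector and its rate, are invariant under the
symbol, whose square there is $L$ or $P$ once advection and lapse are removed. Every reduction
agrees on plane waves, and symmetry with respect to a positive form makes these squares positive
(`pos_of_planeWave`).

The gauge conditions are the lapse and shift components of $\partial\mathcal H_D/\partial p$,
computed in the frame and transformed back. -/

noncomputable section

namespace HamiltonianGR

/-! ### The model system: flat background, unit lapse, vanishing shift -/

section Accessors

variable (x y : Jet) (c : ℝ) (i j k : Fin 3)

@[simp] theorem dMetric_add : dMetric (x + y) i j k = dMetric x i j k + dMetric y i j k := rfl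
@[simp] theorem dLapse_add : dLapse (x + y) i = dLapse x i + dLapse y i := rfl
@[simp] theorem dShift_add : dShift (x + y) i j = dShift x i j + dShift y i j := rfl
@[simp] theorem momPi_add : momPi (x + y) i j = momPi x i j + momPi y i j := rfl
@[simp] theorem momSigma_add : momSigma (x + y) = momSigma x + momSigma y := rfl
@[simp] theorem momRho_add : momRho (x + y) i = momRho x i + momRho y i := rfl
@[simp] theorem dMetric_smul : dMetric (c • x) i j k = c * dMetric x i j k := rfl
@[simp] theorem dLapse_smul : dLapse (c • x) i = c * dLapse x i := rfl
@[simp] theorem dShift_smul : dShift (c • x) i j = c * dShift x i j := rfl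
@[simp] theorem momPi_smul : momPi (c • x) i j = c * momPi x i j := rfl
@[simp] theorem momSigma_smul : momSigma (c • x) = c * momSigma x := rfl
@[simp] theorem momRho_smul : momRho (c • x) i = c * momRho x i := rfl

theorem dMetric_comm : dMetric x i j k = dMetric x i k j := (x.1 i).1.2 j k
theorem momPi_comm : momPi x i j = momPi x j i := x.2.1.2 i j

/-- Oriented forms of the symmetry: rewriting with them leaves only independent components, so that
the large identities below become polynomial identities for `ring`. -/
theorem dMetric_one_zero : dMetric x i 1 0 = dMetric x i 0 1 := dMetric_comm ..
theorem dMetric_two_zero : dMetric x i 2 0 = dMetric x i 0 2 := dMetric_comm ..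
theorem dMetric_two_one : dMetric x i 2 1 = dMetric x i 1 2 := dMetric_comm ..
theorem momPi_one_zero : momPi x 1 0 = momPi x 0 1 := momPi_comm ..
theorem momPi_two_zero : momPi x 2 0 = momPi x 0 2 := momPi_comm ..
theorem momPi_two_one : momPi x 2 1 = momPi x 1 2 := momPi_comm ..

/-- `∂ᵢ gᵢⱼ` -/
def divMetric (x : Jet) (j : Fin 3) : ℝ := ∑ i, dMetric x i i j

/-- `∂ᵢ gⱼⱼ` -/
def dTrace (x : Jet) (i : Fin 3) : ℝ := ∑ j, dMetric x i j j

/-- `∂ᵢ bᵢ` -/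
def divShift (x : Jet) : ℝ := ∑ i, dShift x i i

/-- `πᵢᵢ` -/
def trPi (x : Jet) : ℝ := ∑ i, momPi x i i

theorem jet_ext {x y : Jet} (hg : ∀ i j k, dMetric x i j k = dMetric y i j k)
    (ha : ∀ i, dLapse x i = dLapse y i) (hb : ∀ i j, dShift x i j = dShift y i j)
    (hp : ∀ i j, momPi x i j = momPi y i j) (hs : momSigma x = momSigma y)
    (hr : ∀ i, momRho x i = momRho y i) : x = y :=
  Prod.ext (funext fun i => Prod.ext (Subtype.ext (funext fun j => funext fun k => hg i j k))
      (Prod.ext (ha i) (funext fun j => hb i j)))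
    (Prod.ext (Subtype.ext (funext fun i => funext fun j => hp i j))
      (Prod.ext hs (funext fun i => hr i)))

end Accessors

/-- A bilinear form whose quadratic form is the density of the model system with the speeds
`λ₋² = L` and `λ₊² = P`. -/
def modelForm (L P : ℝ) : LinearMap.BilinForm ℝ Jet :=
  LinearMap.mk₂ ℝ (fun x y =>
      (∑ i, ∑ j, momPi x i j * momPi y i j) - 1 / 2 * trPi x * trPi y
      + 1 / 4 * (∑ k, ∑ i, ∑ j, dMetric x k i j * dMetric y k i j)
      - 1 / 2 * (∑ k, ∑ i, ∑ j, dMetric x k i j * dMetric y i k j)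
      + (∑ k, divMetric x k * (1 / 2 * dTrace y k)) - (∑ k, dTrace x k * (1 / 4 * dTrace y k))
      + (∑ k, (divMetric x k - dTrace x k) * dLapse y k)
      + (∑ i, ∑ j, momPi x i j * (2 * dShift y i j))
      + (∑ i, momRho x i * ((3 * P + 1) / 4 * divMetric y i - (P + 1) / 4 * dTrace y i
          - dLapse y i))
      - L / 2 * trPi x * momSigma y + L / 8 * momSigma x * momSigma y
      - (∑ i, momRho x i * ((3 * P + 1) / 8 * momRho y i)))
    (by
      intro x x' y
      simp only [divMetric, dTrace, trPi, Fin.sum_univ_three, dMetric_add, momPi_add,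
        momSigma_add, momRho_add]
      ring)
    (by
      intro c x y
      simp only [divMetric, dTrace, trPi, Fin.sum_univ_three, dMetric_smul, momPi_smul,
        momSigma_smul, momRho_smul, smul_eq_mul]
      ring)
    (by
      intro x x' y
      simp only [divMetric, dTrace, trPi, Fin.sum_univ_three, dMetric_add, dLapse_add, dShift_add,
        momPi_add, momSigma_add, momRho_add]
      ring)
    (by
      intro c x y
      simp only [divMetric, dTrace, trPi, Fin.sum_univ_three, dMetric_smul, dLapse_smul,
        dShift_smul, momPi_smul, momSigma_smul, momRho_smul, smul_eq_mul]
      ring)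

/-- The second differential of the quadratic form of `b`. -/
def polarization (b : LinearMap.BilinForm ℝ Jet) : Jet →ₗ[ℝ] (Jet →L[ℝ] ℝ) :=
  LinearMap.toContinuousLinearMap.toLinearMap ∘ₗ (b + b.flip)

theorem polarization_apply (b : LinearMap.BilinForm ℝ Jet) (x y : Jet) :
    polarization b x y = b x y + b y x := rfl

/-- The right-hand sides of the canonical equations with the quadratic density whose second
differential is `h`, where `U i` stands for `∂ᵢ u`. -/
def rate (h : Jet →ₗ[ℝ] (Jet →L[ℝ] ℝ)) (U : Fin 3 → Jet) : Jet :=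
  (fun i => momentumGradient (h (U i)), ∑ i, slopeGradient i (h (U i)))

/-- The pairing `πⁱʲ γᵢⱼ + σ α + ρᵢ βⁱ` of momenta and positions. -/
def pair (p : Momenta) (q : Positions) : ℝ :=
  ∑ i, ∑ j, p.1.1 i j * q.1.1 i j + p.2.1 * q.2.1 + ∑ k, p.2.2 k * q.2.2 k

theorem symUnit_apply (i j k l : Fin 3) : (symUnit i j).1 k l =
    ((if k = i ∧ l = j then 1 else 0) + (if k = j ∧ l = i then 1 else 0)) / 2 := rfl

theorem pair_symUnit (p : Momenta) (i j : Fin 3) : pair p (symUnit i j, 0, 0) = p.1.1 i j := by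
  have h : ∀ i j, p.1.1 i j = p.1.1 j i := p.1.2
  fin_cases i <;> fin_cases j <;>
    simp [pair, symUnit_apply, Fin.sum_univ_three, h 1 0, h 2 0, h 2 1] <;> ring

/-- Converse to `gradient_spec`: the pairing is nondegenerate, so every gradient below can be
written down first and then verified by testing against all vectors. -/
theorem gradient_eq_of_pair {ℓ : (SymTensor × ℝ × (Fin 3 → ℝ)) →L[ℝ] ℝ} {p : Momenta}
    (h : ∀ x, ℓ x = pair p x) : gradient ℓ = p := by
  refine Prod.ext (Subtype.ext (funext fun i => funext fun j => ?_)) (Prod.ext ?_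
    (funext fun k => ?_))
  · exact (h (symUnit i j, 0, 0)).trans (pair_symUnit p i j)
  · exact (h (0, 1, 0)).trans (by simp [pair])
  · exact (h (0, 0, Pi.single k 1)).trans (by simp [pair, Pi.single_apply])

/-- The element of `Jet` with the momenta `p` and vanishing slopes. -/
def momJet (p : Momenta) : Jet := (0, p)

/-- The element of `Jet` with `∂ₖ q = v`, whose other components vanish. -/
def slopeJet (k : Fin 3) (v : Positions) : Jet := (Pi.single k v, 0)

section BasicJets

variable (p : Momenta) (v : Positions) (i j k l : Fin 3)

theorem dMetric_momJet : dMetric (momJet p) i j k = 0 := rfl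
theorem dLapse_momJet : dLapse (momJet p) i = 0 := rfl
theorem dShift_momJet : dShift (momJet p) i j = 0 := rfl
theorem momPi_momJet : momPi (momJet p) i j = p.1.1 i j := rfl
theorem momSigma_momJet : momSigma (momJet p) = p.2.1 := rfl
theorem momRho_momJet : momRho (momJet p) i = p.2.2 i := rfl
theorem dMetric_slopeJet : dMetric (slopeJet l v) i j k = if i = l then v.1.1 j k else 0 := by
  unfold dMetric slopeJet
  by_cases h : i = l
  · subst h; simp
  · simp [h]
theorem dLapse_slopeJet : dLapse (slopeJet l v) i = if i = l then v.2.1 else 0 := by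
  unfold dLapse slopeJet
  by_cases h : i = l
  · subst h; simp
  · simp [h]
theorem dShift_slopeJet : dShift (slopeJet l v) i j = if i = l then v.2.2 j else 0 := by
  unfold dShift slopeJet
  by_cases h : i = l
  · subst h; simp
  · simp [h]
theorem momPi_slopeJet : momPi (slopeJet l v) i j = 0 := rfl
theorem momSigma_slopeJet : momSigma (slopeJet l v) = 0 := rfl
theorem momRho_slopeJet : momRho (slopeJet l v) i = 0 := rfl

end BasicJets

theorem momentumGradient_eq_of_pair {ℓ : Jet →L[ℝ] ℝ} {v : Positions}
    (h : ∀ p, ℓ (momJet p) = pair v p) : momentumGradient ℓ = v :=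
  gradient_eq_of_pair h

theorem slopeGradient_eq_of_pair {ℓ : Jet →L[ℝ] ℝ} {k : Fin 3} {p : Momenta}
    (h : ∀ v, ℓ (slopeJet k v) = pair p v) : slopeGradient k ℓ = p :=
  gradient_eq_of_pair h

section ModelRate

variable (L P : ℝ) (U : Fin 3 → Jet)

/-- The right-hand side of `∂ₜ q = …` in the model system. -/
def modelVelocity (x : Jet) : Positions :=
  (⟨fun i j => 2 * momPi x i j + dShift x i j + dShift x j i
      - (if i = j then trPi x + L / 2 * momSigma x else 0), fun i j => by
      simp only [momPi_comm x i j, eq_comm (a := i)]; ring⟩,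
    L / 4 * momSigma x - L / 2 * trPi x,
    fun i => (3 * P + 1) / 4 * (divMetric x i - momRho x i) - (P + 1) / 4 * dTrace x i
      - dLapse x i)

/-- The flux of `p` in the direction `k` in the model system. -/
def modelStress (k : Fin 3) (x : Jet) : Momenta :=
  (⟨fun i j => 1 / 2 * (dMetric x k i j - dMetric x i j k - dMetric x j i k)
      + 1 / 4 * ((if k = i then dTrace x j else 0) + (if k = j then dTrace x i else 0))
      + 1 / 2 * ((if k = i then dLapse x j else 0) + (if k = j then dLapse x i else 0))
      + (3 * P + 1) / 8 * ((if k = i then momRho x j else 0) + (if k = j then momRho x i else 0))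
      + (if i = j then 1 / 2 * divMetric x k - 1 / 2 * dTrace x k - dLapse x k
          - (P + 1) / 4 * momRho x k else 0), fun i j => by
      simp only [dMetric_comm x k i j, eq_comm (a := i) (b := j)]
      split_ifs <;> subst_vars <;> ring⟩,
    divMetric x k - dTrace x k - momRho x k,
    fun i => 2 * momPi x k i)

/-- The canonical equations of the model system. -/
def modelRate : Jet := rate (polarization (modelForm L P)) U

theorem momentumGradient_modelForm (x : Jet) :
    momentumGradient (polarization (modelForm L P) x) = modelVelocity L P x := by
  refine momentumGradient_eq_of_pair fun p => ?_
  rw [polarization_apply, modelForm, LinearMap.mk₂_apply, LinearMap.mk₂_apply]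
  simp only [pair, modelVelocity, divMetric, dTrace, trPi, Fin.sum_univ_three, dMetric_momJet,
    dLapse_momJet, dShift_momJet, momPi_momJet, momSigma_momJet, momRho_momJet]
  have h : ∀ i j, p.1.1 i j = p.1.1 j i := p.1.2
  simp [h 1 0, h 2 0, h 2 1]
  ring

theorem slopeGradient_modelForm (k : Fin 3) (x : Jet) :
    slopeGradient k (polarization (modelForm L P) x) = modelStress P k x := by
  refine slopeGradient_eq_of_pair fun v => ?_
  rw [polarization_apply, modelForm, LinearMap.mk₂_apply, LinearMap.mk₂_apply]
  simp only [pair, modelStress, divMetric, dTrace, trPi, Fin.sum_univ_three, dMetric_slopeJet,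
    dLapse_slopeJet, dShift_slopeJet, momPi_slopeJet, momSigma_slopeJet, momRho_slopeJet]
  have h : ∀ i j, v.1.1 i j = v.1.1 j i := v.1.2
  fin_cases k <;>
  · simp [h 1 0, h 2 0, h 2 1, dMetric_one_zero, dMetric_two_zero,
      dMetric_two_one, momPi_one_zero, momPi_two_zero, momPi_two_one]
    ring

theorem modelRate_eq : modelRate L P U =
    (fun i => modelVelocity L P (U i), ∑ k, modelStress P k (U k)) := by
  simp only [modelRate, rate, momentumGradient_modelForm, slopeGradient_modelForm]

theorem modelRate_dMetric (k i j : Fin 3) : dMetric (modelRate L P U) k i j =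
    2 * momPi (U k) i j + dShift (U k) i j + dShift (U k) j i
      - (if i = j then trPi (U k) + L / 2 * momSigma (U k) else 0) := by
  rw [modelRate_eq]; rfl

theorem modelRate_dLapse (k : Fin 3) : dLapse (modelRate L P U) k =
    L / 4 * momSigma (U k) - L / 2 * trPi (U k) := by
  rw [modelRate_eq]; rfl

theorem modelRate_dShift (k i : Fin 3) : dShift (modelRate L P U) k i =
    (3 * P + 1) / 4 * (divMetric (U k) i - momRho (U k) i) - (P + 1) / 4 * dTrace (U k) i
      - dLapse (U k) i := by
  rw [modelRate_eq]; rfl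

theorem modelRate_momPi (i j : Fin 3) : momPi (modelRate L P U) i j =
    ∑ k, (modelStress P k (U k)).1.1 i j := by
  rw [modelRate_eq, Fin.sum_univ_three, Fin.sum_univ_three]; rfl

theorem modelRate_momSigma : momSigma (modelRate L P U) =
    ∑ k, (divMetric (U k) k - dTrace (U k) k - momRho (U k) k) := by
  rw [modelRate_eq, Fin.sum_univ_three, Fin.sum_univ_three]; rfl

theorem modelRate_momRho (i : Fin 3) : momRho (modelRate L P U) i =
    ∑ k, 2 * momPi (U k) k i := by
  rw [modelRate_eq, Fin.sum_univ_three, Fin.sum_univ_three]; rfl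

end ModelRate

/-! ### A symmetrizer of the model system -/

section Combinations

variable (x : Jet) (i j k : Fin 3)

/-- `∂ᵢ gⱼₖ - ∂ⱼ gᵢₖ` -/
def curlMetric : ℝ := dMetric x i j k - dMetric x j i k

/-- A combination of slopes and momenta with the same speeds as `ρ`. -/
def shiftPotential : ℝ := 3 / 2 * divMetric x i - 1 / 2 * dTrace x i - 3 / 2 * momRho x i

/-- A combination of slopes and momenta with the same speeds as `σ`. -/
def lapsePotential : ℝ := dTrace x i - divMetric x i + momRho x i

/-- The symmetric part of `∂ᵢ bⱼ`. -/
def strain : ℝ := (dShift x i j + dShift x j i) / 2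

/-- The antisymmetric part of `∂ᵢ bⱼ`. -/
def vorticity : ℝ := (dShift x i j - dShift x j i) / 2

end Combinations

/-- The part of the symmetrizer of the model system in `(∂ᵢ gⱼₖ, ∂ᵢ a, ρᵢ)`. -/
def symmetrizerEven (P q r ε : ℝ) (x y : Jet) : ℝ :=
  (1 / 8 - ε / 2) * (∑ k, ∑ i, ∑ j, curlMetric x k i j * curlMetric y k i j)
  - 1 / 8 * (∑ j, (divMetric x j - dTrace x j) * (divMetric y j - dTrace y j))
  -- Together with the $-\varepsilon/2$ above, the $\varepsilon$-terms equal
  -- $\varepsilon(\partial_kg_{ij}\partial_ig_{kj}-\partial_ig_{ij}\partial_kg_{kj})$, a total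
  -- divergence. Adding it does not affect conservation of the energy, and for small $\varepsilon>0$
  -- it gives control of all of $\partial g$.
  + ε * ((∑ k, ∑ i, ∑ j, dMetric x k i j * dMetric y k i j) - ∑ j, divMetric x j * divMetric y j)
  + P / 4 * (∑ j, (3 / 2 * momRho x j * momRho y j + momRho x j * shiftPotential y j
      + shiftPotential x j * momRho y j + 4 * shiftPotential x j * shiftPotential y j))
  + q * (∑ j, lapsePotential x j * lapsePotential y j)
  -- In the model $\partial_ta=-\frac L2(\mathrm{tr}\,\pi-\frac12\sigma)$ and
  -- $\partial_t(\mathrm{tr}\,\pi-\frac12\sigma)=-2\Delta a$. The terms with weight $r$ here and in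
  -- `symmetrizerOdd` form the energy of this decoupled wave equation.
  + 4 * r * (∑ j, dLapse x j * dLapse y j)

/-- The part of the symmetrizer of the model system in `(∂ᵢ bⱼ, πᵢⱼ, σ)`. -/
def symmetrizerOdd (L q r A : ℝ) (x y : Jet) : ℝ :=
  (∑ i, ∑ j, (momPi x i j + strain x i j) * (momPi y i j + strain y i j))
  - 1 / 2 * trPi x * trPi y
  + 4 * (divShift x - trPi x / 2) * (divShift y - trPi y / 2)
  + (∑ i, ∑ j, strain x i j * strain y i j)
  - 2 * divShift x * divShift y
  -- The rate of `lapsePotential` is $-L\,\partial\sigma$ plus a double curl of the shift. The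
  -- $q$-terms therefore need a vorticity term whose weight is tied to $q$.
  + (2 * A - 2) * (∑ i, ∑ j, vorticity x i j * vorticity y i j)
  + L * q * momSigma x * momSigma y
  + L * r * (trPi x - momSigma x / 2) * (trPi y - momSigma y / 2)

/-- The part of the flux of the symmetrizer that pairs `(∂ᵢ gⱼₖ, ∂ᵢ a, ρᵢ)` of `x` with
`(∂ᵢ bⱼ, πᵢⱼ, σ)` of `y`. -/
def fluxExpr (L P q r ε : ℝ) (p : Fin 3) (x y : Jet) : ℝ :=
  (1 / 8 - ε / 2) * (4 * (∑ i, ∑ j, curlMetric x p i j * momPi y i j)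
      + 2 * (divMetric x p - dTrace x p) * trPi y)
  - 1 / 4 * (∑ j, (divMetric x j - dTrace x j) * momPi y p j)
  + ε * (2 * (∑ i, ∑ j, dMetric x p i j * momPi y i j) - dTrace x p * trPi y
      - 2 * (∑ j, divMetric x j * momPi y p j) + divMetric x p * trPi y)
  + P / 4 * (3 * (∑ j, momRho x j * momPi y p j) - momRho x p * trPi y
      + 2 * (∑ j, shiftPotential x j * momPi y p j) - 4 * shiftPotential x p * trPi y)
  - 2 * r * L * dLapse x p * trPi y
  + (r * L * dLapse x p - q * L * lapsePotential x p) * momSigma y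
  - (3 * P + 1) / 4 * (∑ j, strain y p j * momRho x j)
  - (2 * q + 3 * P - 1 / 4) * (∑ j, vorticity y p j * momRho x j)
  + (1 / 4 - 7 / 4 * P) * divShift y * momRho x p
  - ((∑ i, dShift y i p * dLapse x i) - dLapse x p * divShift y)
  + (∑ i, ∑ j, (1 / 2 * dMetric x p i j + (ε - 1 / 4) * dMetric x i p j
      + (ε - 1 / 4) * dMetric x j p i) * dShift y i j)
  + (∑ j, ((q + 9 / 4 * P - ε - 1 / 8) * divMetric x j
      + (1 / 8 - 3 / 4 * P - q) * dTrace x j) * dShift y p j)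
  + (∑ j, ((1 / 8 - 3 / 4 * P - ε - q) * divMetric x j
      + (q + 1 / 4 * P - 1 / 8) * dTrace x j) * dShift y j p)
  + (3 / 2 * P * divMetric x p - 1 / 2 * P * dTrace x p) * divShift y

/-- The symmetrizer of the model system. -/
def symmetrizer (L P q r ε A : ℝ) : LinearMap.BilinForm ℝ Jet :=
  LinearMap.mk₂ ℝ (fun x y => symmetrizerEven P q r ε x y + symmetrizerOdd L q r A x y)
    (by
      intro x x' y
      simp only [symmetrizerEven, symmetrizerOdd, curlMetric, shiftPotential, lapsePotential,
        strain, vorticity, divMetric, dTrace, trPi, divShift, Fin.sum_univ_three, dMetric_add,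
        dLapse_add, dShift_add, momPi_add, momSigma_add, momRho_add]
      ring)
    (by
      intro c x y
      simp only [symmetrizerEven, symmetrizerOdd, curlMetric, shiftPotential, lapsePotential,
        strain, vorticity, divMetric, dTrace, trPi, divShift, Fin.sum_univ_three, dMetric_smul,
        dLapse_smul, dShift_smul, momPi_smul, momSigma_smul, momRho_smul, smul_eq_mul]
      ring)
    (by
      intro x x' y
      simp only [symmetrizerEven, symmetrizerOdd, curlMetric, shiftPotential, lapsePotential,
        strain, vorticity, divMetric, dTrace, trPi, divShift, Fin.sum_univ_three, dMetric_add,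
        dLapse_add, dShift_add, momPi_add, momSigma_add, momRho_add]
      ring)
    (by
      intro c x y
      simp only [symmetrizerEven, symmetrizerOdd, curlMetric, shiftPotential, lapsePotential,
        strain, vorticity, divMetric, dTrace, trPi, divShift, Fin.sum_univ_three, dMetric_smul,
        dLapse_smul, dShift_smul, momPi_smul, momSigma_smul, momRho_smul, smul_eq_mul]
      ring)

/-- The flux of the symmetrizer of the model system. -/
def symmetrizerFlux (L P q r ε : ℝ) (p : Fin 3) : LinearMap.BilinForm ℝ Jet :=
  LinearMap.mk₂ ℝ (fluxExpr L P q r ε p)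
    (by
      intro x x' y
      simp only [fluxExpr, curlMetric, shiftPotential, lapsePotential, strain, vorticity,
        divMetric, dTrace, trPi, divShift, Fin.sum_univ_three, dMetric_add, dLapse_add, momRho_add]
      ring)
    (by
      intro c x y
      simp only [fluxExpr, curlMetric, shiftPotential, lapsePotential, strain, vorticity,
        divMetric, dTrace, trPi, divShift, Fin.sum_univ_three, dMetric_smul, dLapse_smul,
        momRho_smul, smul_eq_mul]
      ring)
    (by
      intro x x' y
      simp only [fluxExpr, strain, vorticity,
        trPi, divShift, Fin.sum_univ_three, dShift_add,
        momPi_add, momSigma_add]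
      ring)
    (by
      intro c x y
      simp only [fluxExpr, strain, vorticity,
        trPi, divShift, Fin.sum_univ_three,
        dShift_smul, momPi_smul, momSigma_smul, smul_eq_mul]
      ring)

/-! ### Conservation of the model energy. -/

section Conservation

variable {U : Fin 3 → Jet}

theorem dMetric_slope_comm (hU : ∀ p i, (U p).1 i = (U i).1 p)
    (p k i j : Fin 3) : dMetric (U p) k i j = dMetric (U k) p i j := by
  unfold dMetric; rw [hU]

theorem dLapse_slope_comm (hU : ∀ p i, (U p).1 i = (U i).1 p)
    (p k : Fin 3) : dLapse (U p) k = dLapse (U k) p := by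
  unfold dLapse; rw [hU]

theorem dShift_slope_comm (hU : ∀ p i, (U p).1 i = (U i).1 p)
    (p k i : Fin 3) : dShift (U p) k i = dShift (U k) p i := by
  unfold dShift; rw [hU]

-- The rates of the even variables contain second derivatives of the shift only; after commuting
-- these, both sides agree coefficient by coefficient.
set_option maxHeartbeats 4000000 in
set_option maxRecDepth 10000 in
theorem symmetrizerEven_modelRate (hU : ∀ p i, (U p).1 i = (U i).1 p)
    (L P q r ε : ℝ) (x : Jet) :
    symmetrizerEven P q r ε x (modelRate L P U) = ∑ p, fluxExpr L P q r ε p x (U p) := by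
  have e1 := dShift_slope_comm hU 1 0
  have e2 := dShift_slope_comm hU 2 0
  have e3 := dShift_slope_comm hU 2 1
  simp only [symmetrizerEven, fluxExpr, curlMetric, shiftPotential, lapsePotential, strain,
    vorticity, divMetric, dTrace, modelRate_dMetric, modelRate_dLapse, modelRate_momRho, trPi,
    divShift, Fin.sum_univ_three, dMetric_one_zero, dMetric_two_zero, dMetric_two_one,
    momPi_one_zero, momPi_two_zero, momPi_two_one, e1, e2, e3, Fin.isValue,
    Fin.reduceEq, if_true, if_false]
  ring

-- The same flux with its arguments exchanged, which is what makes `symmetrizerFlux` plus its flip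
-- work for both blocks. The relation `hq` matches the products of vorticity and $\rho$: it says
-- $(2A-2)\frac{3P+1}4=2q+3P-\frac14$.
set_option maxHeartbeats 4000000 in
set_option maxRecDepth 10000 in
theorem symmetrizerOdd_modelRate (hU : ∀ p i, (U p).1 i = (U i).1 p)
    {P q A : ℝ} (hq : q = A * ((3 * P + 1) / 4) - 1 / 8 - 9 / 4 * P) (L r ε : ℝ) (x : Jet) :
    symmetrizerOdd L q r A x (modelRate L P U) = ∑ p, fluxExpr L P q r ε p (U p) x := by
  have e1 := dMetric_slope_comm hU 1 0
  have e2 := dMetric_slope_comm hU 2 0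
  have e3 := dMetric_slope_comm hU 2 1
  have f1 := dLapse_slope_comm hU 1 0
  have f2 := dLapse_slope_comm hU 2 0
  have f3 := dLapse_slope_comm hU 2 1
  subst hq
  simp only [symmetrizerOdd, fluxExpr, curlMetric, shiftPotential, lapsePotential, strain,
    vorticity, divMetric, dTrace, modelRate_dShift, modelRate_momPi, modelRate_momSigma,
    modelStress, trPi, divShift, Fin.sum_univ_three, dMetric_one_zero, dMetric_two_zero,
    dMetric_two_one, momPi_one_zero, momPi_two_zero, momPi_two_one, e1, e2, e3, f1, f2, f3,
    Fin.isValue, Fin.reduceEq, if_true, if_false]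
  ring

end Conservation

/-! ### Positivity of the model energy. -/

section Positivity

/-- The vector on the left is a trace of the curl with two nonzero terms per component. The factor 2
from $(a+b)^2\le2(a^2+b^2)$ is compensated by antisymmetry, since each of these entries occurs twice
on the right. The constant 1 matters: it leaves a deficit of only $\varepsilon/2$ in the even block.
-/
theorem sq_trace_le_curlMetric (x : Jet) :
    ∑ j, (divMetric x j - dTrace x j) ^ 2 ≤ ∑ k, ∑ i, ∑ j, curlMetric x k i j ^ 2 := by
  have h : ∀ a b : ℝ, (a + b) ^ 2 ≤ 2 * (a ^ 2 + b ^ 2) := fun a b => by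
    nlinarith [sq_nonneg (a - b)]
  have h0 := h (curlMetric x 1 0 1) (curlMetric x 2 0 2)
  have h1 := h (curlMetric x 0 1 0) (curlMetric x 2 1 2)
  have h2 := h (curlMetric x 0 2 0) (curlMetric x 1 2 1)
  have g0 := sq_nonneg (curlMetric x 0 1 2)
  have g1 := sq_nonneg (curlMetric x 0 2 1)
  have g2 := sq_nonneg (curlMetric x 1 2 0)
  simp only [divMetric, dTrace, curlMetric, Fin.sum_univ_three, dMetric_one_zero, dMetric_two_zero,
    dMetric_two_one, Fin.isValue] at h0 h1 h2 g0 g1 g2 ⊢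
  linarith

/-- Here $r,z,t$ stand for components of $\rho$, `shiftPotential` and `lapsePotential`, in terms of
which `divMetric` minus `dTrace` is $r-t$ and `divMetric` is $z+t/2+r$. The two negative squares are
the $\varepsilon$-losses of the even block; $64\varepsilon\le P$ and $\varepsilon\le\frac14$ make
them small against the positive definite remainder. -/
theorem vector_form_ge {P q ε : ℝ} (hε : 0 ≤ ε) (hP : 64 * ε ≤ P) (h4 : ε ≤ 1 / 4) (hq : 1 ≤ q)
    (r z t : ℝ) :
    P / 16 * (r ^ 2 + z ^ 2) + 1 / 2 * t ^ 2 ≤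
      P / 4 * (3 / 2 * r ^ 2 + 2 * r * z + 4 * z ^ 2) + q * t ^ 2 - ε / 2 * (r - t) ^ 2
        - ε * (z + t / 2 + r) ^ 2 := by
  have h1 : ε * (1 / 2 * (r - t) ^ 2 + (z + t / 2 + r) ^ 2) ≤
      ε * (4 * (r ^ 2 + z ^ 2) + 2 * t ^ 2) := by
    refine mul_le_mul_of_nonneg_left ?_ hε
    nlinarith [sq_nonneg (r + t), sq_nonneg (z - t / 2), sq_nonneg (z - r), sq_nonneg (r - t / 2),
      sq_nonneg z, sq_nonneg t]
  have h2 : ε * (r ^ 2 + z ^ 2) ≤ P / 64 * (r ^ 2 + z ^ 2) :=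
    mul_le_mul_of_nonneg_right (by linarith) (by positivity)
  have h3 : ε * t ^ 2 ≤ 1 / 4 * t ^ 2 := mul_le_mul_of_nonneg_right h4 (by positivity)
  have h5 : 1 * t ^ 2 ≤ q * t ^ 2 := mul_le_mul_of_nonneg_right hq (by positivity)
  have h6 : 0 ≤ P * ((r + z) ^ 2 + 3 / 2 * z ^ 2) := mul_nonneg (by linarith) (by positivity)
  nlinarith [h1, h2, h3, h5, h6, mul_nonneg (by linarith : 0 ≤ P) (sq_nonneg z)]

theorem symmetrizerEven_ge {P q r ε : ℝ} (hε : 0 ≤ ε) (hP : 64 * ε ≤ P) (h4 : ε ≤ 1 / 4)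
    (hq : 1 ≤ q) (x : Jet) :
    ε * (∑ k, ∑ i, ∑ j, dMetric x k i j ^ 2)
      + (∑ j, (P / 16 * (momRho x j ^ 2 + shiftPotential x j ^ 2) + 1 / 2 * lapsePotential x j ^ 2))
      + 4 * r * (∑ j, dLapse x j ^ 2) ≤ symmetrizerEven P q r ε x x := by
  have h1 := mul_le_mul_of_nonneg_left (sq_trace_le_curlMetric x)
    (by linarith : 0 ≤ 1 / 8 - ε / 2)
  have h2 : ∀ j, P / 16 * (momRho x j ^ 2 + shiftPotential x j ^ 2) + 1 / 2 * lapsePotential x j ^ 2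
      ≤ P / 4 * (3 / 2 * momRho x j ^ 2 + 2 * momRho x j * shiftPotential x j
        + 4 * shiftPotential x j ^ 2) + q * lapsePotential x j ^ 2
        - ε / 2 * (divMetric x j - dTrace x j) ^ 2 - ε * divMetric x j ^ 2 := by
    intro j
    refine (vector_form_ge hε hP h4 hq _ _ _).trans (le_of_eq ?_)
    simp only [shiftPotential, lapsePotential]
    ring
  have h3 := Finset.sum_le_sum fun j (_ : j ∈ Finset.univ) => h2 j
  simp only [Finset.sum_add_distrib, Finset.sum_sub_distrib, ← Finset.mul_sum] at h3
  simp only [symmetrizerEven, ← pow_two, Finset.sum_add_distrib, ← Finset.mul_sum, mul_add,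
    mul_assoc,
    mul_comm (shiftPotential x _) (momRho x _)] at h1 h3 ⊢
  linarith

/-- Since $4(d-\tau/2)^2-2d^2=2(d-\tau)^2-\tau^2$ for $d=\partial_ib_i$, $\tau=\mathrm{tr}\,\pi$,
the total loss is at most $\frac32\tau^2$. The thresholds 2 and 5 suffice because
$\sigma^2+5(\tau-\sigma/2)^2-\frac32\tau^2$ is positive definite in $(\tau,\sigma)$. -/
theorem symmetrizerOdd_ge {L q r A : ℝ} (hq : 2 ≤ L * q) (hr : 5 ≤ L * r) (x : Jet) :
    (∑ i, ∑ j, (momPi x i j + strain x i j) ^ 2) + (∑ i, ∑ j, strain x i j ^ 2)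
      + (2 * A - 2) * (∑ i, ∑ j, vorticity x i j ^ 2) + momSigma x ^ 2 ≤
      symmetrizerOdd L q r A x x := by
  have h1 := mul_le_mul_of_nonneg_right hq (sq_nonneg (momSigma x))
  have h2 := mul_le_mul_of_nonneg_right hr (sq_nonneg (trPi x - momSigma x / 2))
  simp only [symmetrizerOdd, ← pow_two]
  nlinarith [sq_nonneg (2 * divShift x - trPi x), sq_nonneg (trPi x - momSigma x),
    sq_nonneg (divShift x), sq_nonneg (divShift x - trPi x / 2),
    sq_nonneg (divShift x - trPi x / 2 - trPi x), sq_nonneg (trPi x - momSigma x / 2)]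

theorem symmetrizer_apply (L P q r ε A : ℝ) (x y : Jet) : symmetrizer L P q r ε A x y =
    symmetrizerEven P q r ε x y + symmetrizerOdd L q r A x y := rfl

theorem symmetrizer_comm (L P q r ε A : ℝ) (x y : Jet) :
    symmetrizer L P q r ε A x y = symmetrizer L P q r ε A y x := by
  simp only [symmetrizer_apply, symmetrizerEven, symmetrizerOdd, Fin.sum_univ_three]
  ring

/-- The two lower bounds are sums of squares that determine the whole jet: $\partial g$, $\partial
a$, $\rho$ from the even block; strain, vorticity, $\pi$ plus strain, and $\sigma$ from the odd one.
If the energy is not positive, all of them vanish. -/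
theorem symmetrizer_pos {L P q r ε A : ℝ} (hε : 0 < ε) (hP : 64 * ε ≤ P) (h4 : ε ≤ 1 / 4)
    (hq : 1 ≤ q) (hLq : 2 ≤ L * q) (hr : 0 < r) (hLr : 5 ≤ L * r) (hA : 1 < A) {x : Jet}
    (hx : x ≠ 0) : 0 < symmetrizer L P q r ε A x x := by
  by_contra hneg
  apply hx
  have hP0 : 0 < P := by linarith
  have hA' : 0 < 2 * A - 2 := by linarith
  have h1 := symmetrizerEven_ge (r := r) hε.le hP h4 hq x
  have h2 := symmetrizerOdd_ge (A := A) hLq hLr x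
  rw [symmetrizer_apply] at hneg
  have hg : 0 ≤ ∑ k, ∑ i, ∑ j, dMetric x k i j ^ 2 := by positivity
  have hv : 0 ≤ ∑ j, (P / 16 * (momRho x j ^ 2 + shiftPotential x j ^ 2)
      + 1 / 2 * lapsePotential x j ^ 2) := by positivity
  have ha : 0 ≤ ∑ j, dLapse x j ^ 2 := by positivity
  have hp : 0 ≤ ∑ i, ∑ j, (momPi x i j + strain x i j) ^ 2 := by positivity
  have hS : 0 ≤ ∑ i, ∑ j, strain x i j ^ 2 := by positivity
  have hW : 0 ≤ ∑ i, ∑ j, vorticity x i j ^ 2 := by positivity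
  have hs : 0 ≤ momSigma x ^ 2 := by positivity
  have hg' := mul_nonneg hε.le hg
  have ha' : 0 ≤ 4 * r * ∑ j, dLapse x j ^ 2 := by positivity
  have hW' := mul_nonneg hA'.le hW
  have two : ∀ f : Fin 3 → Fin 3 → ℝ, ∑ i, ∑ j, f i j ^ 2 ≤ 0 → ∀ i j, f i j = 0 := by
    intro f hf i j
    have := (Finset.sum_eq_zero_iff_of_nonneg fun i _ => Finset.sum_nonneg fun j _ =>
      sq_nonneg (f i j)).1 (le_antisymm hf (by positivity)) i (Finset.mem_univ i)
    exact pow_eq_zero_iff two_ne_zero |>.1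
      ((Finset.sum_eq_zero_iff_of_nonneg fun j _ => sq_nonneg (f i j)).1 this j (Finset.mem_univ j))
  have three : ∀ k i j, dMetric x k i j = 0 := by
    intro k
    refine two _ ?_
    have hle : ∑ k, ∑ i, ∑ j, dMetric x k i j ^ 2 ≤ 0 :=
      nonpos_of_mul_nonpos_right (by linarith) hε
    exact (Finset.single_le_sum (f := fun k => ∑ i, ∑ j, dMetric x k i j ^ 2)
      (fun k _ => by positivity) (Finset.mem_univ k)).trans hle
  have hS0 := two (strain x) (by linarith)
  have hW0 := two (vorticity x) (nonpos_of_mul_nonpos_right (by linarith) hA')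
  have hp0 := two (fun i j => momPi x i j + strain x i j) (by linarith)
  refine jet_ext three (fun i => ?_) (fun i j => ?_) (fun i j => ?_) ?_ (fun i => ?_)
  · have hle : ∑ j, dLapse x j ^ 2 ≤ 0 :=
      nonpos_of_mul_nonpos_right (by linarith) (by linarith : 0 < 4 * r)
    exact pow_eq_zero_iff two_ne_zero |>.1 ((Finset.sum_eq_zero_iff_of_nonneg
      fun j _ => sq_nonneg (dLapse x j)).1 (le_antisymm hle ha) i (Finset.mem_univ i))
  · have e1 := hS0 i j
    have e2 := hW0 i j
    simp only [strain, vorticity] at e1 e2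
    change dShift x i j = 0
    linarith
  · have e1 := hS0 i j
    have e2 := hp0 i j
    simp only [e1, add_zero] at e2
    exact e2
  · exact pow_eq_zero_iff two_ne_zero |>.1 (le_antisymm (by linarith) hs)
  · have hle : ∑ j, (P / 16 * (momRho x j ^ 2 + shiftPotential x j ^ 2)
      + 1 / 2 * lapsePotential x j ^ 2) ≤ 0 := by linarith
    have h0 := (Finset.sum_eq_zero_iff_of_nonneg fun j _ => by positivity).1
      (le_antisymm hle hv) i (Finset.mem_univ i)
    have h3 : P / 16 * momRho x i ^ 2 ≤ 0 := by
      have : 0 ≤ P / 16 * shiftPotential x i ^ 2 + 1 / 2 * lapsePotential x i ^ 2 := by positivity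
      linarith
    exact pow_eq_zero_iff two_ne_zero |>.1 (le_antisymm
      (nonpos_of_mul_nonpos_right h3 (by linarith : 0 < P / 16)) (sq_nonneg (momRho x i)))

end Positivity

/-! ### Symmetrizers, reductions and changes of variables -/

/-- `U p` can be `∂ₚ u` for `u = (∂ᵢ q, p)`. -/
def IsCurlFree (U : Fin 3 → Jet) : Prop := ∀ p i, (U p).1 i = (U i).1 p

/-- The first order system `∂ₜ u = R (∂ u)` has a positive definite symmetrizer, up to multiples of
the auxiliary constraints. -/
def HasSymmetrizer (R : (Fin 3 → Jet) → Jet) : Prop :=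
  ∃ (H : LinearMap.BilinForm ℝ Jet) (T : Fin 3 → LinearMap.BilinForm ℝ Jet),
    (∀ x y, H x y = H y x) ∧ (∀ x, x ≠ 0 → 0 < H x x) ∧ (∀ p x y, T p x y = T p y x) ∧
      ∀ U, IsCurlFree U → ∀ x, ∑ p, T p x (U p) = H x (R U)

theorem hasSymmetrizer_modelRate {L P : ℝ} (hL : 0 < L) (hP : 0 < P) :
    HasSymmetrizer (modelRate L P) := by
  have hV : 0 < (3 * P + 1) / 4 := by linarith
  obtain ⟨A, hA, q, hq, hq1, hLq⟩ : ∃ A : ℝ, 1 < A ∧ ∃ q : ℝ,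
      q = A * ((3 * P + 1) / 4) - 1 / 8 - 9 / 4 * P ∧ 1 ≤ q ∧ 2 ≤ L * q := by
    have h2L : 0 < 2 / L := by positivity
    -- The witness gives $q=2/L+2+2\cdot\frac{3P+1}4-\frac18$. Raising $A$ raises $q$ because
    -- $\frac{3P+1}4>0$, so both lower bounds on $q$ and $A>1$ can be met at once.
    refine ⟨(2 / L + 2 + 9 / 4 * P) / ((3 * P + 1) / 4) + 2, ?_, _, rfl, ?_, ?_⟩
    · have : 0 ≤ (2 / L + 2 + 9 / 4 * P) / ((3 * P + 1) / 4) := by positivity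
      linarith
    · rw [add_mul, div_mul_cancel₀ _ hV.ne']
      linarith
    · rw [add_mul, div_mul_cancel₀ _ hV.ne']
      have h : L * (2 / L) = 2 := mul_div_cancel₀ _ hL.ne'
      have h' : 0 ≤ L * (2 + 2 * ((3 * P + 1) / 4) - 1 / 8) := by
        apply mul_nonneg hL.le; linarith
      nlinarith
  obtain ⟨ε, hε, hPε, h4⟩ : ∃ ε : ℝ, 0 < ε ∧ 64 * ε ≤ P ∧ ε ≤ 1 / 4 :=
    ⟨min (P / 64) (1 / 4), by positivity, by linarith [min_le_left (P / 64) (1 / 4 : ℝ)],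
      min_le_right _ _⟩
  refine ⟨symmetrizer L P q (5 / L) ε A,
    fun p => symmetrizerFlux L P q (5 / L) ε p + (symmetrizerFlux L P q (5 / L) ε p).flip,
    symmetrizer_comm _ _ _ _ _ _, fun x hx => symmetrizer_pos hε hPε h4 hq1 hLq (by positivity)
      (by rw [mul_div_cancel₀ _ hL.ne']) hA hx, fun p x y => ?_, fun U hU x => ?_⟩
  · simp only [LinearMap.add_apply]
    exact add_comm _ _
  · rw [symmetrizer_apply, symmetrizerEven_modelRate hU, symmetrizerOdd_modelRate hU hq L (5 / L) ε,
      ← Finset.sum_add_distrib]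
    rfl

/-- Splitting a jet into its slopes and momenta reassembles the four coefficient families into the
hessian, so a reduction is any linear extension of `rate` from curl-free derivatives. -/
theorem isFirstOrderReduction_canonicalSystem {𝓗 : Density} {q : Positions} {u : Jet}
    {𝔸 : Fin 3 → Jet →ₗ[ℝ] Jet} :
    (canonicalSystem 𝓗 q u).IsFirstOrderReduction 𝔸 ↔
      ∀ U, IsCurlFree U → ∑ p, 𝔸 p (U p) = rate (hessian 𝓗 q u) U := by
  have key : ∀ U : Fin 3 → Jet,
      ((fun i => (∑ j, (canonicalSystem 𝓗 q u).A₁ j ((U i).1 j)) +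
          (canonicalSystem 𝓗 q u).A₂ (U i).2,
        (∑ i, ∑ j, (canonicalSystem 𝓗 q u).B₁ i j ((U i).1 j)) +
          ∑ i, (canonicalSystem 𝓗 q u).B₂ i (U i).2) : Jet) = rate (hessian 𝓗 q u) U := by
    intro U
    have hsplit : ∀ x : Jet, x = ∑ j, LinearMap.inl ℝ (Fin 3 → Positions) Momenta
        (LinearMap.single ℝ (fun _ : Fin 3 => Positions) j (x.1 j)) +
        LinearMap.inr ℝ (Fin 3 → Positions) Momenta x.2 := by
      intro x
      rw [← map_sum]
      refine Prod.ext ?_ ?_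
      · simp [Finset.univ_sum_single]
      · simp [Prod.snd_sum]
    refine Prod.ext (funext fun i => ?_) ?_
    · change _ = momentumGradient (hessian 𝓗 q u (U i))
      conv_rhs => rw [hsplit (U i)]
      simp only [map_add, map_sum]
      rfl
    · change _ = ∑ i, slopeGradient i (hessian 𝓗 q u (U i))
      conv_rhs =>
        enter [2, i]
        rw [hsplit (U i)]
        simp only [map_add, map_sum]
      rw [Finset.sum_add_distrib]
      rfl
  constructor
  · intro h U hU
    rw [← key]
    exact h (fun p => (U p).1) (fun p => (U p).2) hU
  · intro h vv ww hvv
    have := h (fun p => (vv p, ww p)) hvv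
    rw [← key] at this
    exact this

/-- Positive definiteness makes $H$ invertible, so the flux forms alone determine a reduction
$\mathbb A^p=H^{-1}T^p$, and $H\mathbb A^p=T^p$ is symmetric by construction. -/
theorem isSymmetricHyperbolic_of_hasSymmetrizer {𝓗 : Density} {q : Positions} {u : Jet}
    (h : HasSymmetrizer (rate (hessian 𝓗 q u))) :
    (canonicalSystem 𝓗 q u).IsSymmetricHyperbolic := by
  obtain ⟨H, T, hsymm, hpos, hT, hHT⟩ := h
  have hnd : H.Nondegenerate := by
    refine ⟨fun x hx => ?_, fun x hx => ?_⟩ <;>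
    · by_contra hne
      exact (hpos x hne).ne' (hx x)
  let 𝔸 : Fin 3 → Jet →ₗ[ℝ] Jet := fun p => (H.toDual hnd).symm.toLinearMap ∘ₗ T p
  have h𝔸 : ∀ p x y, H (𝔸 p x) y = T p x y := fun p x y => by
    rw [← LinearMap.BilinForm.toDual_def hnd]
    simp [𝔸]
  refine ⟨𝔸, isFirstOrderReduction_canonicalSystem.2 fun U hU => ?_, H, hsymm, hpos,
    fun p x y => ?_⟩
  -- The two sides have the same $H$-product with every vector, in particular with their difference.
  · rw [← sub_eq_zero]
    by_contra hne
    refine (hpos _ hne).ne' ?_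
    have : ∀ x, H x (∑ p, 𝔸 p (U p) - rate (hessian 𝓗 q u) U) = 0 := by
      intro x
      rw [map_sub, ← hHT U hU, map_sum, sub_eq_zero]
      refine Finset.sum_congr rfl fun p _ => ?_
      rw [hsymm, h𝔸, hT]
    exact this _
  · rw [h𝔸, hsymm, h𝔸, hT]

/-- The differential of a quadratic density. -/
theorem fderiv_eq_polarization {𝓗 : Density} {q : Positions} (b : LinearMap.BilinForm ℝ Jet)
    (hb : ∀ u, 𝓗 q u = b u u) (u : Jet) : fderiv ℝ (𝓗 q) u = polarization b u := by
  let B₀ : Jet →ₗ[ℝ] Jet →L[ℝ] ℝ := LinearMap.toContinuousLinearMap.toLinearMap ∘ₗ b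
  let B : Jet →L[ℝ] Jet →L[ℝ] ℝ := LinearMap.toContinuousLinearMap (𝕜 := ℝ) (E := Jet)
    (F' := Jet →L[ℝ] ℝ) B₀
  have h2 : 𝓗 q = fun u => B u u := funext hb
  rw [h2]
  have h3 : HasFDerivAt (fun u => B u u) _ u :=
    B.hasFDerivAt.clm_apply (hasFDerivAt_id u)
  rw [h3.fderiv]
  exact ContinuousLinearMap.ext fun v => rfl

/-- The hessian of a quadratic density. -/
theorem hessian_eq_polarization {𝓗 : Density} {q : Positions} (b : LinearMap.BilinForm ℝ Jet)
    (hb : ∀ u, 𝓗 q u = b u u) (u : Jet) : hessian 𝓗 q u = polarization b := by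
  let D : Jet →L[ℝ] Jet →L[ℝ] ℝ := LinearMap.toContinuousLinearMap (𝕜 := ℝ) (E := Jet)
    (F' := Jet →L[ℝ] ℝ) (polarization b)
  have h4 : (fun u' => fderiv ℝ (𝓗 q) u') = D := funext (fderiv_eq_polarization b hb)
  rw [hessian, h4, ContinuousLinearMap.fderiv]
  rfl

theorem gradient_pair (ℓ : (SymTensor × ℝ × (Fin 3 → ℝ)) →L[ℝ] ℝ)
    (x : SymTensor × ℝ × (Fin 3 → ℝ)) : ℓ x = pair (gradient ℓ) x := gradient_spec ℓ x

/-- The pairing of momenta and positions as a bilinear form. -/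
def pairForm : Momenta →ₗ[ℝ] Positions →ₗ[ℝ] ℝ :=
  LinearMap.mk₂ ℝ pair
    (by
      intro p p' v
      simp [pair, Fin.sum_univ_three]
      ring)
    (by
      intro c p v
      simp [pair, Fin.sum_univ_three]
      ring)
    (by
      intro p v v'
      simp [pair, Fin.sum_univ_three]
      ring)
    (by
      intro c p v
      simp [pair, Fin.sum_univ_three]
      ring)

theorem pair_comm (p : Momenta) (v : Positions) : pair p v = pair v p := by
  simp only [pair, mul_comm]

/-- The quadratic form `βⁱ pₙ ∂ᵢ qₙ` of the shift advection. -/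
def advectionForm (β : Fin 3 → ℝ) : LinearMap.BilinForm ℝ Jet :=
  ∑ i, β i • pairForm.compl₁₂ (LinearMap.snd ℝ (Fin 3 → Positions) Momenta)
    (LinearMap.proj i ∘ₗ LinearMap.fst ℝ (Fin 3 → Positions) Momenta)

theorem advectionForm_apply (β : Fin 3 → ℝ) (x y : Jet) :
    advectionForm β x y = ∑ i, β i * pair x.2 (y.1 i) := by
  simp [advectionForm, pairForm]

/-! ### Behaviour of the canonical equations under linear changes of variables. -/

section ChangeOfFrame

variable (f : Matrix (Fin 3) (Fin 3) ℝ) (φ : Positions ≃ₗ[ℝ] Positions)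
  (ψ : Momenta ≃ₗ[ℝ] Momenta)

/-- The change of variables induced by the frame `f` and by linear transformations of positions and
momenta. -/
def frameMap : Jet →ₗ[ℝ] Jet :=
  LinearMap.prodMap
    (LinearMap.pi fun a => ∑ i, f i a • (φ.toLinearMap ∘ₗ LinearMap.proj i)) ψ.toLinearMap

theorem frameMap_fst (x : Jet) (a : Fin 3) : (frameMap f φ ψ x).1 a = ∑ i, f i a • φ (x.1 i) := by
  simp [frameMap]

theorem frameMap_snd (x : Jet) : (frameMap f φ ψ x).2 = ψ x.2 := rfl

/-- The derivatives of the transformed variables along the frame `f`. -/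
def frameDerivative (U : Fin 3 → Jet) (a : Fin 3) : Jet := ∑ i, f i a • frameMap f φ ψ (U i)

variable {f φ ψ}

/-- The frame is constant, so second derivatives are contracted with $f_{ia}f_{jb}$ and stay
symmetric. -/
theorem isCurlFree_frameDerivative {U : Fin 3 → Jet} (hU : IsCurlFree U) :
    IsCurlFree (frameDerivative f φ ψ U) := by
  have h : ∀ a b, (frameDerivative f φ ψ U a).1 b =
      ∑ i, ∑ j, (f i a * f j b) • φ ((U i).1 j) := by
    intro a b
    simp only [frameDerivative, Prod.fst_sum, Finset.sum_apply, Prod.smul_fst, Pi.smul_apply,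
      frameMap_fst, Finset.smul_sum, smul_smul]
  intro a b
  rw [h, h, Finset.sum_comm]
  refine Finset.sum_congr rfl fun i _ => Finset.sum_congr rfl fun j _ => ?_
  rw [hU, mul_comm]

theorem frameMap_injective {e : Matrix (Fin 3) (Fin 3) ℝ} (hfe : f * e = 1) :
    Function.Injective (frameMap f φ ψ) := by
  rw [← LinearMap.ker_eq_bot, LinearMap.ker_eq_bot']
  intro x hx
  have h1 : ∀ a, ∑ i, f i a • φ (x.1 i) = 0 := fun a => by
    rw [← frameMap_fst f φ ψ, hx]; rfl
  have h2 : ψ x.2 = 0 := by rw [← frameMap_snd f φ ψ, hx]; rfl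
  refine Prod.ext (funext fun j => ?_) (by simpa using h2)
  apply φ.injective
  -- Contracting with the dual frame recovers the original slopes.
  have h3 : ∑ a, e a j • ∑ i, f i a • φ (x.1 i) = ∑ i, (f * e) i j • φ (x.1 i) := by
    simp only [Finset.smul_sum, smul_smul, Matrix.mul_apply, Finset.sum_smul]
    rw [Finset.sum_comm]
    simp only [mul_comm]
  rw [hfe] at h3
  simp only [h1, smul_zero, Finset.sum_const_zero, Matrix.one_apply, ite_smul, one_smul,
    zero_smul, Finset.sum_ite_eq', Finset.mem_univ, if_true] at h3
  rw [← h3]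
  simp

theorem frameMap_slopeJet (i : Fin 3) (v : Positions) :
    frameMap f φ ψ (slopeJet i v) = ∑ a, f i a • slopeJet a (φ v) := by
  refine Prod.ext (funext fun a => ?_) ?_
  · rw [frameMap_fst, Prod.fst_sum, Finset.sum_apply]
    simp only [slopeJet, Prod.smul_fst, Pi.smul_apply, Pi.single_apply]
    simp [apply_ite φ]
  · rw [frameMap_snd, Prod.snd_sum]
    simp [slopeJet]

theorem polarization_frame {b₀ b : LinearMap.BilinForm ℝ Jet} {α s : ℝ} {β : Fin 3 → ℝ}
    (hb : b = (α * s) • b₀.compl₁₂ (frameMap f φ ψ) (frameMap f φ ψ) + advectionForm β)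
    (x y : Jet) :
    polarization b x y =
      α * s * polarization b₀ (frameMap f φ ψ x) (frameMap f φ ψ y) +
        ((∑ i, β i * pair x.2 (y.1 i)) + ∑ i, β i * pair y.2 (x.1 i)) := by
  simp only [polarization_apply, hb, LinearMap.add_apply, LinearMap.smul_apply,
    LinearMap.compl₁₂_apply, advectionForm_apply, smul_eq_mul]
  ring

theorem momentumGradient_frame {b₀ b : LinearMap.BilinForm ℝ Jet} {α s : ℝ} {β : Fin 3 → ℝ}
    (hb : b = (α * s) • b₀.compl₁₂ (frameMap f φ ψ) (frameMap f φ ψ) + advectionForm β)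
    (hs : ∀ p v, pair p v = s * pair (ψ p) (φ v)) (x : Jet) :
    momentumGradient (polarization b x) =
      α • φ.symm (momentumGradient (polarization b₀ (frameMap f φ ψ x))) + ∑ i, β i • x.1 i := by
  refine momentumGradient_eq_of_pair fun p => ?_
  rw [polarization_frame hb]
  have h1 : polarization b₀ (frameMap f φ ψ x) (frameMap f φ ψ (momJet p)) =
      pair (momentumGradient (polarization b₀ (frameMap f φ ψ x))) (ψ p) := by
    have h2 : frameMap f φ ψ (momJet p) = momJet (ψ p) := by
      refine Prod.ext (funext fun a => ?_) rfl
      rw [frameMap_fst]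
      simp [momJet]
    rw [h2]
    exact gradient_pair (((polarization b₀) (frameMap f φ ψ x)).comp
      (ContinuousLinearMap.inr ℝ (Fin 3 → Positions) Momenta)) (ψ p)
  have h3 : ∀ v, pair v p = pairForm p v := fun v => pair_comm _ _
  rw [h1, h3, map_add, map_smul, map_sum]
  simp only [map_smul, smul_eq_mul]
  change _ = α * pair _ _ + ∑ i, β i * pair _ _
  rw [hs p, LinearEquiv.apply_symm_apply, pair_comm (ψ p)]
  have h4 : ∀ i, pair x.2 ((momJet p).1 i) = 0 := fun i => (pairForm x.2).map_zero
  simp only [h4, mul_zero, Finset.sum_const_zero, zero_add]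
  simp only [momJet]
  ring

/-- A change of variables that preserves the pairing up to $s$ carries Hamilton's equations to
Hamilton's equations, dividing the Hamiltonian by $s$; of the prefactor $\alpha s$ only $\alpha$
survives. The advection form generates $\beta^i\partial_iu$ for positions and momenta alike; for the
slopes this uses curl-freeness. -/
theorem frameMap_rate {b₀ b : LinearMap.BilinForm ℝ Jet} {α s : ℝ} {β : Fin 3 → ℝ}
    (hb : b = (α * s) • b₀.compl₁₂ (frameMap f φ ψ) (frameMap f φ ψ) + advectionForm β)
    (hs : ∀ p v, pair p v = s * pair (ψ p) (φ v)) {U : Fin 3 → Jet} (hU : IsCurlFree U) :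
    frameMap f φ ψ (rate (polarization b) U) =
      α • rate (polarization b₀) (frameDerivative f φ ψ U) + ∑ i, β i • frameMap f φ ψ (U i) := by
  have hmom := fun x => momentumGradient_frame hb hs x
  have hslope : ∀ i x, slopeGradient i (polarization b x) =
      α • ∑ a, f i a • ψ.symm (slopeGradient a (polarization b₀ (frameMap f φ ψ x)))
        + β i • x.2 := by
    intro i x
    refine slopeGradient_eq_of_pair fun v => ?_
    rw [polarization_frame hb, frameMap_slopeJet, map_sum]
    have h1 : ∀ a, polarization b₀ (frameMap f φ ψ x) (slopeJet a (φ v)) =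
        pair (slopeGradient a (polarization b₀ (frameMap f φ ψ x))) (φ v) := fun a =>
      gradient_pair ((((polarization b₀) (frameMap f φ ψ x)).comp
        (ContinuousLinearMap.inl ℝ (Fin 3 → Positions) Momenta)).comp
        (ContinuousLinearMap.single ℝ (fun _ : Fin 3 => Positions) a)) (φ v)
    have h3 : ∀ p, pair p v = pairForm.flip v p := fun v => rfl
    rw [h3, map_add, map_smul, map_sum]
    simp only [map_smul, smul_eq_mul, h1]
    have h5 : ∀ p, pairForm.flip v (ψ.symm p) = s * pair p (φ v) := fun p => by
      change pair _ _ = _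
      rw [hs, LinearEquiv.apply_symm_apply]
    have h6 : ∀ j, pair x.2 ((slopeJet i v).1 j) = if j = i then pair x.2 v else 0 := by
      intro j
      by_cases hj : j = i
      · subst hj; simp [slopeJet]
      · simp only [slopeJet, hj, if_false, Pi.single_eq_of_ne hj]
        exact (pairForm x.2).map_zero
    have h7 : ∀ j, pair (slopeJet i v).2 (x.1 j) = 0 := fun j => (pairForm.flip (x.1 j)).map_zero
    simp only [h5, h6, h7, mul_ite, mul_zero, Finset.sum_const_zero, add_zero, Finset.sum_ite_eq',
      Finset.mem_univ, if_true]
    rw [← h3, Finset.mul_sum, Finset.mul_sum]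
    congr 1
    refine Finset.sum_congr rfl fun a _ => ?_
    ring
  refine Prod.ext (funext fun a => ?_) ?_
  · rw [frameMap_fst]
    simp only [rate, hmom, map_add, map_smul, map_sum, LinearEquiv.apply_symm_apply]
    simp only [Prod.fst_add, Prod.smul_fst, Pi.add_apply, Pi.smul_apply, Prod.fst_sum,
      Finset.sum_apply, frameMap_fst, frameDerivative, map_sum, map_smul, smul_add,
      Finset.sum_add_distrib, Finset.smul_sum, smul_smul]
    congr 1
    · refine Finset.sum_congr rfl fun i _ => ?_
      rw [mul_comm]
    · rw [Finset.sum_comm]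
      refine Finset.sum_congr rfl fun i _ => Finset.sum_congr rfl fun j _ => ?_
      rw [hU, mul_comm]
  · rw [frameMap_snd]
    simp only [rate, hslope, map_add, map_smul, map_sum, LinearEquiv.apply_symm_apply]
    simp only [Prod.snd_add, Prod.smul_snd, Prod.snd_sum, frameMap_snd, frameDerivative, map_sum,
      map_smul, Finset.sum_add_distrib, Finset.smul_sum, smul_smul]
    congr 1
    rw [Finset.sum_comm]

/-- The symmetrizer is pulled back. Advection is a multiple of the identity in each direction, so it
adds $\beta^iH$ to the flux, which is symmetric. -/
theorem hasSymmetrizer_of_frameMap {e : Matrix (Fin 3) (Fin 3) ℝ} (hfe : f * e = 1)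
    {R R₀ : (Fin 3 → Jet) → Jet} {α : ℝ} {β : Fin 3 → ℝ}
    (hR : ∀ U, IsCurlFree U → frameMap f φ ψ (R U) =
      α • R₀ (frameDerivative f φ ψ U) + ∑ i, β i • frameMap f φ ψ (U i))
    (h : HasSymmetrizer R₀) : HasSymmetrizer R := by
  obtain ⟨H, T, hsymm, hpos, hT, hHT⟩ := h
  let Φ := frameMap f φ ψ
  refine ⟨H.compl₁₂ Φ Φ, fun i => (∑ a, (α * f i a) • (T a).compl₁₂ Φ Φ) + β i • H.compl₁₂ Φ Φ,
    fun x y => hsymm _ _, fun x hx => hpos _ ?_, fun i x y => ?_, fun U hU x => ?_⟩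
  · exact (map_ne_zero_iff _ (frameMap_injective hfe)).2 hx
  · simp only [LinearMap.add_apply, LinearMap.sum_apply, LinearMap.smul_apply,
      LinearMap.compl₁₂_apply, hT _ (Φ x), hsymm (Φ x)]
  · rw [LinearMap.compl₁₂_apply, hR U hU, map_add, map_smul,
      ← hHT _ (isCurlFree_frameDerivative hU)]
    simp only [frameDerivative, LinearMap.add_apply, LinearMap.sum_apply, LinearMap.smul_apply,
      LinearMap.compl₁₂_apply, map_sum, map_smul, smul_eq_mul, Finset.sum_add_distrib,
      Finset.mul_sum]
    congr 1
    rw [Finset.sum_comm]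
    refine Finset.sum_congr rfl fun a _ => Finset.sum_congr rfl fun i _ => ?_
    ring

end ChangeOfFrame

/-! ### Reduction of the formulations to the model system -/

open Matrix

section Frames

-- A positive matrix has the form $e^*e$; the columns of $f=e^{-1}$ are an orthonormal frame.
open scoped MatrixOrder Matrix.Norms.L2Operator in
theorem exists_frame {q : Positions} (hq : (metric q).PosDef) :
    ∃ e f : Matrix (Fin 3) (Fin 3) ℝ, f * e = 1 ∧ e * f = 1 ∧ metric q = eᵀ * e ∧
      invMetric q = f * fᵀ := by
  obtain ⟨e, he⟩ := CStarAlgebra.nonneg_iff_eq_star_mul_self.mp hq.posSemidef.nonneg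
  have he' : metric q = eᵀ * e := by
    rw [he, star_eq_conjTranspose, conjTranspose_eq_transpose_of_trivial]
  have hu : IsUnit e.det := by
    have h := hq.det_pos.ne'
    rw [he', det_mul] at h
    exact isUnit_iff_ne_zero.2 (right_ne_zero_of_mul h)
  have h1 := nonsing_inv_mul e hu
  have h2 := mul_nonsing_inv e hu
  refine ⟨e, e⁻¹, h1, h2, he', ?_⟩
  rw [invMetric, he']
  refine inv_eq_right_inv ?_
  rw [mul_assoc, ← mul_assoc e, h2, one_mul, ← transpose_mul, h1, transpose_one]

/-- `T ↦ m T mᵀ` -/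
def congruence (m : Matrix (Fin 3) (Fin 3) ℝ) : SymTensor →ₗ[ℝ] SymTensor where
  toFun T := ⟨fun a b => (m * of T.1 * mᵀ) a b, fun a b => by
    have hT : (of T.1)ᵀ = of T.1 := by
      ext i j
      exact T.2 j i
    have : (m * of T.1 * mᵀ)ᵀ = m * of T.1 * mᵀ := by
      rw [transpose_mul, transpose_mul, hT, transpose_transpose, mul_assoc]
    exact congrFun (congrFun this b) a⟩
  map_add' S T := by
    apply Subtype.ext
    change (m * (of S.1 + of T.1) * mᵀ : Matrix _ _ ℝ) = m * of S.1 * mᵀ + m * of T.1 * mᵀ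
    rw [mul_add, add_mul]
  map_smul' c T := by
    apply Subtype.ext
    change (m * (c • of T.1) * mᵀ : Matrix _ _ ℝ) = c • (m * of T.1 * mᵀ)
    rw [Matrix.mul_smul, Matrix.smul_mul]

theorem congruence_congruence {m n : Matrix (Fin 3) (Fin 3) ℝ} (h : m * n = 1) (T : SymTensor) :
    congruence m (congruence n T) = T := by
  apply Subtype.ext
  change (m * (n * of T.1 * nᵀ) * mᵀ : Matrix _ _ ℝ) = of T.1
  rw [← mul_assoc, ← mul_assoc, h, one_mul, mul_assoc, ← transpose_mul, h, transpose_one, mul_one]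

/-- `T ↦ m T mᵀ` for an invertible matrix `m`. -/
def congruenceEquiv {m n : Matrix (Fin 3) (Fin 3) ℝ} (h : m * n = 1) (h' : n * m = 1) :
    SymTensor ≃ₗ[ℝ] SymTensor :=
  { congruence m with
    invFun := congruence n
    left_inv := congruence_congruence h'
    right_inv := congruence_congruence h }

variable {e f : Matrix (Fin 3) (Fin 3) ℝ} (hfe : f * e = 1) (hef : e * f = 1) {α s : ℝ}
  (hα : α ≠ 0) (hs : s ≠ 0)

/-- Components of positions with respect to the frame `f`, scaled by the lapse. -/
def framePositions : Positions ≃ₗ[ℝ] Positions :=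
  LinearEquiv.prodCongr
    (congruenceEquiv (m := fᵀ) (n := eᵀ) (by rw [← transpose_mul, hef, transpose_one])
      (by rw [← transpose_mul, hfe, transpose_one]))
    (LinearEquiv.prodCongr (LinearEquiv.smulOfNeZero ℝ ℝ α⁻¹ (inv_ne_zero hα))
      ((toLin'OfInv hfe hef).trans
        (LinearEquiv.smulOfNeZero ℝ (Fin 3 → ℝ) α⁻¹ (inv_ne_zero hα))))

/-- Components of momenta with respect to the frame `f`, scaled by the lapse and the volume
element. -/
def frameMomenta : Momenta ≃ₗ[ℝ] Momenta :=
  LinearEquiv.prodCongr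
    ((congruenceEquiv hef hfe).trans
      (LinearEquiv.smulOfNeZero ℝ SymTensor s⁻¹ (inv_ne_zero hs)))
    (LinearEquiv.prodCongr (LinearEquiv.smulOfNeZero ℝ ℝ (α / s) (div_ne_zero hα hs))
      ((toLin'OfInv (M := eᵀ) (M' := fᵀ) (by rw [← transpose_mul, hfe, transpose_one])
        (by rw [← transpose_mul, hef, transpose_one])).trans
        (LinearEquiv.smulOfNeZero ℝ (Fin 3 → ℝ) (α / s) (div_ne_zero hα hs))))

theorem framePositions_metric (v : Positions) (a b : Fin 3) :
    (framePositions hfe hef hα v).1.1 a b = (fᵀ * of v.1.1 * f) a b := rfl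

theorem framePositions_lapse (v : Positions) :
    (framePositions hfe hef hα v).2.1 = α⁻¹ * v.2.1 := rfl

theorem framePositions_shift (v : Positions) (a : Fin 3) :
    (framePositions hfe hef hα v).2.2 a = α⁻¹ * ∑ j, e a j * v.2.2 j := rfl

theorem frameMomenta_pi (p : Momenta) (a b : Fin 3) :
    (frameMomenta hfe hef hα hs p).1.1 a b = s⁻¹ * (e * of p.1.1 * eᵀ) a b := rfl

theorem frameMomenta_sigma (p : Momenta) :
    (frameMomenta hfe hef hα hs p).2.1 = α / s * p.2.1 := rfl

theorem frameMomenta_rho (p : Momenta) (a : Fin 3) :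
    (frameMomenta hfe hef hα hs p).2.2 a = α / s * ∑ i, f i a * p.2.2 i := rfl

theorem sum_mul_eq_trace (S T : Matrix (Fin 3) (Fin 3) ℝ) :
    ∑ i, ∑ j, S i j * T i j = (S * Tᵀ).trace := by
  simp [Matrix.trace, Matrix.mul_apply]

theorem sum_frame (v w : Fin 3 → ℝ) (h : f * e = 1) :
    ∑ a, (∑ i, f i a * v i) * (∑ j, e a j * w j) = ∑ i, v i * w i := by
  have h1 : ∀ a, (∑ i, f i a * v i) = (v ᵥ* f) a := fun a => by
    simp [vecMul, dotProduct, mul_comm]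
  have h2 : ∀ a, (∑ j, e a j * w j) = (e *ᵥ w) a := fun a => rfl
  simp only [h1, h2]
  change v ᵥ* f ⬝ᵥ e *ᵥ w = v ⬝ᵥ w
  rw [dotProduct_mulVec, vecMul_vecMul, h, vecMul_one]

/-- Frame components of tensors and cotensors contract invariantly, and the lapse weights
$\alpha^{-1}$ and $\alpha$ cancel, leaving the density weight $s$. -/
theorem pair_frame (p : Momenta) (v : Positions) :
    pair p v = s * pair (frameMomenta hfe hef hα hs p) (framePositions hfe hef hα v) := by
  have h1 : ∑ a, ∑ b, (e * of p.1.1 * eᵀ) a b * (fᵀ * of v.1.1 * f) a b =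
      ∑ i, ∑ j, of p.1.1 i j * of v.1.1 i j := by
    rw [sum_mul_eq_trace, sum_mul_eq_trace, transpose_mul, transpose_mul, transpose_transpose,
      show e * of p.1.1 * eᵀ * (fᵀ * ((of v.1.1)ᵀ * f)) =
        e * (of p.1.1 * (eᵀ * fᵀ) * (of v.1.1)ᵀ * f) by simp only [mul_assoc],
      trace_mul_comm, ← transpose_mul, hfe, transpose_one, mul_one, mul_assoc, hfe, mul_one]
  have h2 := sum_frame p.2.2 v.2.2 hfe
  simp only [of_apply] at h1
  simp only [pair, framePositions_metric, framePositions_lapse, framePositions_shift,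
    frameMomenta_pi, frameMomenta_sigma, frameMomenta_rho, mul_assoc, ← Finset.mul_sum,
    mul_left_comm _ α⁻¹ _]
  simp only [← mul_assoc] at h1 h2 ⊢
  rw [h1, h2]
  field_simp

end Frames

/-! ### Contractions with the metric as Euclidean contractions of frame components. -/

section Covariance

variable {e f : Matrix (Fin 3) (Fin 3) ℝ}

theorem sum_invMetric {q : Positions} (hq : invMetric q = f * fᵀ) (v w : Fin 3 → ℝ) :
    ∑ i, ∑ j, invMetric q i j * v i * w j = ∑ a, (∑ i, f i a * v i) * (∑ j, f j a * w j) := by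
  simp only [hq, Matrix.mul_apply, transpose_apply, Fin.sum_univ_three]
  ring

theorem invMetric_comm {q : Positions} (hq : invMetric q = f * fᵀ) (i j : Fin 3) :
    invMetric q i j = invMetric q j i := by
  simp only [hq, Matrix.mul_apply, transpose_apply, mul_comm]

/-- `γʲᵏ ∂ⱼ γₖₗ` -/
def covDivMetric (q : Positions) (u : Jet) (l : Fin 3) : ℝ :=
  ∑ j, ∑ k, invMetric q j k * dMetric u j k l

/-- `γʲᵏ ∂ₗ γⱼₖ` -/
def covDTrace (q : Positions) (u : Jet) (l : Fin 3) : ℝ :=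
  ∑ j, ∑ k, invMetric q j k * dMetric u l j k

/-- Both contracted Christoffel symbols reduce to two traces of $\partial\gamma$, which transform as
covectors under a constant frame (`divMetric_frameJet`, `dTrace_frameJet`). -/
theorem christoffelTrace_eq {q : Positions} (hq : ∀ i j, invMetric q i j = invMetric q j i)
    (u : Jet) (i : Fin 3) : christoffelTrace q u i =
      ∑ l, invMetric q i l * (covDivMetric q u l - 1 / 2 * covDTrace q u l) := by
  simp only [christoffelTrace, christoffel, covDivMetric, covDTrace, Fin.sum_univ_three,
    hq 1 0, hq 2 0, hq 2 1, dMetric_one_zero, dMetric_two_zero, dMetric_two_one]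
  ring

theorem sum_christoffel_eq {q : Positions} (hq : ∀ i j, invMetric q i j = invMetric q j i)
    (u : Jet) (k : Fin 3) : ∑ l, christoffel q u l k l = 1 / 2 * covDTrace q u k := by
  simp only [christoffel, covDTrace, Fin.sum_univ_three,
    hq 1 0, hq 2 0, hq 2 1, dMetric_one_zero, dMetric_two_zero, dMetric_two_one]
  ring

theorem christoffelContr_eq {q : Positions} (hq : ∀ i j, invMetric q i j = invMetric q j i)
    (u : Jet) (i : Fin 3) : christoffelContr q u i =
      ∑ l, invMetric q i l * (1 / 2 * covDTrace q u l) := by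
  refine Finset.sum_congr rfl fun j _ => ?_
  rw [← sum_christoffel_eq hq, ← Finset.sum_mul, mul_comm, hq i j]
  congr 1
  refine Finset.sum_congr rfl fun k _ => ?_
  simp only [christoffel, Fin.sum_univ_three, dMetric_comm u _ k j]
  ring

/-- The Christoffel symbol with all indices down. -/
def loweredChristoffel (u : Jet) (l i j : Fin 3) : ℝ :=
  1 / 2 * (dMetric u i j l + dMetric u j i l - dMetric u l i j)

variable (hfe : f * e = 1) (hef : e * f = 1) {α s : ℝ} (hα : α ≠ 0) (hs : s ≠ 0)

/-- The jet in the frame variables. -/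
def frameJet : Jet →ₗ[ℝ] Jet :=
  frameMap f (framePositions hfe hef hα) (frameMomenta hfe hef hα hs)

variable (u : Jet) (a b c : Fin 3)

theorem dMetric_frameJet : dMetric (frameJet hfe hef hα hs u) a b c =
    ∑ i, ∑ j, ∑ k, f i a * f j b * f k c * dMetric u i j k := by
  unfold dMetric
  rw [frameJet, frameMap_fst]
  simp only [Fin.sum_univ_three]
  change f 0 a * (fᵀ * of (u.1 0).1.1 * f) b c + f 1 a * (fᵀ * of (u.1 1).1.1 * f) b c +
    f 2 a * (fᵀ * of (u.1 2).1.1 * f) b c = _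
  simp only [Matrix.mul_apply, transpose_apply, of_apply, Fin.sum_univ_three]
  ring

theorem dLapse_frameJet : dLapse (frameJet hfe hef hα hs u) a =
    α⁻¹ * ∑ i, f i a * dLapse u i := by
  unfold dLapse
  rw [frameJet, frameMap_fst]
  simp only [Fin.sum_univ_three]
  change f 0 a * (α⁻¹ * (u.1 0).2.1) + f 1 a * (α⁻¹ * (u.1 1).2.1) +
    f 2 a * (α⁻¹ * (u.1 2).2.1) = _
  ring

theorem dShift_frameJet : dShift (frameJet hfe hef hα hs u) a b =
    α⁻¹ * (fᵀ * of (dShift u) * eᵀ) a b := by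
  unfold dShift
  rw [frameJet, frameMap_fst]
  simp only [Fin.sum_univ_three]
  change f 0 a * (α⁻¹ * ∑ j, e b j * (u.1 0).2.2 j) + f 1 a * (α⁻¹ * ∑ j, e b j * (u.1 1).2.2 j) +
    f 2 a * (α⁻¹ * ∑ j, e b j * (u.1 2).2.2 j) = _
  simp only [Matrix.mul_apply, transpose_apply, of_apply, Fin.sum_univ_three]
  ring

theorem momPi_frameJet : momPi (frameJet hfe hef hα hs u) a b =
    s⁻¹ * (e * of (momPi u) * eᵀ) a b := rfl

theorem momSigma_frameJet : momSigma (frameJet hfe hef hα hs u) = α / s * momSigma u := rfl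

theorem momRho_frameJet : momRho (frameJet hfe hef hα hs u) a =
    α / s * ∑ i, f i a * momRho u i := rfl

variable {q : Positions}

theorem divMetric_frameJet (hq : invMetric q = f * fᵀ) :
    divMetric (frameJet hfe hef hα hs u) a = ∑ l, f l a * covDivMetric q u l := by
  simp only [divMetric, dMetric_frameJet, covDivMetric, hq, Matrix.mul_apply, transpose_apply,
    Fin.sum_univ_three]
  ring

theorem dTrace_frameJet (hq : invMetric q = f * fᵀ) :
    dTrace (frameJet hfe hef hα hs u) a = ∑ l, f l a * covDTrace q u l := by
  simp only [dTrace, dMetric_frameJet, covDTrace, hq, Matrix.mul_apply, transpose_apply,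
    Fin.sum_univ_three]
  ring

theorem loweredChristoffel_frameJet : loweredChristoffel (frameJet hfe hef hα hs u) a b c =
    ∑ i, f i b * (fᵀ * of (fun l j => loweredChristoffel u l i j) * f) a c := by
  simp only [loweredChristoffel, dMetric_frameJet, Matrix.mul_apply, transpose_apply, of_apply,
    Fin.sum_univ_three]
  ring

/-- Under a constant frame the lowered symbols transform as a tensor. Each raised index contributes
$ff^T$, and cyclicity of the trace distributes these factors over the two symbols. -/
theorem sum_christoffel_mul_christoffel (hq : invMetric q = f * fᵀ) :
    ∑ i, ∑ j, invMetric q i j * (∑ k, ∑ l, christoffel q u k i l * christoffel q u l j k) =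
      ∑ a, ∑ b, ∑ c, loweredChristoffel (frameJet hfe hef hα hs u) b a c *
        loweredChristoffel (frameJet hfe hef hα hs u) c a b := by
  let N : Fin 3 → Matrix (Fin 3) (Fin 3) ℝ := fun i => of fun l j => loweredChristoffel u l i j
  have h5 : ∀ M M' : Matrix (Fin 3) (Fin 3) ℝ, ∑ b, ∑ c, M b c * M' c b = (M * M').trace := by
    intro M M'
    simp only [Matrix.trace, diag_apply, Matrix.mul_apply]
  have h1 : ∀ i j, ∑ k, ∑ l, christoffel q u k i l * christoffel q u l j k =
      ((fᵀ * N i * f) * (fᵀ * N j * f)).trace := by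
    intro i j
    have h2 : ∀ i k l, christoffel q u k i l = (f * fᵀ * N i) k l := by
      intro i k l
      rw [← hq, Matrix.mul_apply, christoffel, Finset.mul_sum]
      refine Finset.sum_congr rfl fun m _ => ?_
      simp only [N, of_apply, loweredChristoffel]
      ring
    simp only [h2, h5]
    rw [mul_assoc f, mul_assoc f, mul_assoc f, trace_mul_comm]
    simp only [mul_assoc]
  have h4 : ∀ a b c, loweredChristoffel (frameJet hfe hef hα hs u) b a c =
      (∑ i, f i a • (fᵀ * N i * f)) b c := by
    intro a b c
    rw [loweredChristoffel_frameJet]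
    simp only [Matrix.sum_apply, Matrix.smul_apply, smul_eq_mul, N]
  have h6 : ∀ a, ((∑ i, f i a • (fᵀ * N i * f)) * ∑ j, f j a • (fᵀ * N j * f)).trace =
      ∑ i, ∑ j, f i a * f j a * ((fᵀ * N i * f) * (fᵀ * N j * f)).trace := by
    intro a
    simp only [Finset.sum_mul_sum, trace_sum, Matrix.smul_mul, Matrix.mul_smul, trace_smul,
      smul_eq_mul]
    refine Finset.sum_congr rfl fun i _ => Finset.sum_congr rfl fun j _ => ?_
    ring
  simp only [h1, h4, h5, h6, hq]
  have h7 : ∀ i j, (f * fᵀ) i j = ∑ a, f i a * f j a := fun i j => Matrix.mul_apply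
  simp only [h7, Fin.sum_univ_three]
  ring

theorem tracePi_eq (hq : metric q = eᵀ * e) :
    tracePi q u = s * trPi (frameJet hfe hef hα hs u) := by
  have h : ∑ a, (e * of (momPi u) * eᵀ) a a = tracePi q u := by
    change (e * of (momPi u) * eᵀ).trace = _
    have h2 : (of (momPi u))ᵀ = of (momPi u) := by
      ext i j; exact momPi_comm u j i
    rw [tracePi, show (∑ i, ∑ j, metric q i j * momPi u i j) =
      ∑ i, ∑ j, metric q i j * of (momPi u) i j from rfl, sum_mul_eq_trace, h2, hq, mul_assoc,
      trace_mul_comm, mul_assoc, trace_mul_comm]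
  simp only [trPi, momPi_frameJet, ← Finset.mul_sum, h]
  field_simp

theorem sum_momPi_mul_momPi (hq : metric q = eᵀ * e) :
    ∑ i, ∑ j, ∑ k, ∑ l, metric q i k * metric q j l * momPi u i j * momPi u k l =
      s ^ 2 * ∑ a, ∑ b, momPi (frameJet hfe hef hα hs u) a b *
        momPi (frameJet hfe hef hα hs u) a b := by
  have h2 : (of (momPi u))ᵀ = of (momPi u) := by
    ext i j; exact momPi_comm u j i
  have h3 : (metric q)ᵀ = metric q := by rw [hq, transpose_mul, transpose_transpose]
  have h4 : ∑ i, ∑ j, ∑ k, ∑ l, metric q i k * metric q j l * momPi u i j * momPi u k l =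
      ∑ i, ∑ j, of (momPi u) i j * (metric q * of (momPi u) * (metric q)ᵀ) i j := by
    refine Finset.sum_congr rfl fun i _ => Finset.sum_congr rfl fun j _ => ?_
    simp only [Matrix.mul_apply, of_apply, transpose_apply, Fin.sum_univ_three]
    ring
  have h5 : ∑ a, ∑ b, (e * of (momPi u) * eᵀ) a b * (e * of (momPi u) * eᵀ) a b =
      ∑ i, ∑ j, of (momPi u) i j * (metric q * of (momPi u) * (metric q)ᵀ) i j := by
    rw [sum_mul_eq_trace, sum_mul_eq_trace]
    simp only [transpose_mul, transpose_transpose, h2, hq]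
    rw [mul_assoc e, mul_assoc e, trace_mul_comm]
    simp only [mul_assoc]
  rw [h4, ← h5]
  simp only [momPi_frameJet, Finset.mul_sum]
  refine Finset.sum_congr rfl fun i _ => Finset.sum_congr rfl fun j _ => ?_
  field_simp

theorem sum_momPi_mul_dShift (hq : metric q = eᵀ * e) :
    ∑ i, ∑ j, momPi u i j * ∑ k, (metric q k j * dShift u i k + metric q i k * dShift u j k) =
      α * s * ∑ a, ∑ b, momPi (frameJet hfe hef hα hs u) a b *
        (2 * dShift (frameJet hfe hef hα hs u) a b) := by
  have h3 : (metric q)ᵀ = metric q := by rw [hq, transpose_mul, transpose_transpose]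
  have h1 : ∑ i, ∑ j, momPi u i j * ∑ k, (metric q k j * dShift u i k + metric q i k * dShift u j k)
      = 2 * ∑ i, ∑ j, of (momPi u) i j * (of (dShift u) * metric q) i j := by
    have h3' : ∀ i j, metric q i j = metric q j i := fun i j => congrFun (congrFun h3 j) i
    simp only [Matrix.mul_apply, of_apply, Fin.sum_univ_three, h3' 1 0, h3' 2 0, h3' 2 1,
      momPi_one_zero, momPi_two_zero, momPi_two_one]
    ring
  have h2 : ∑ a, ∑ b, (e * of (momPi u) * eᵀ) a b * (fᵀ * of (dShift u) * eᵀ) a b =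
      ∑ i, ∑ j, of (momPi u) i j * (of (dShift u) * metric q) i j := by
    rw [sum_mul_eq_trace, sum_mul_eq_trace]
    simp only [transpose_mul, transpose_transpose, hq]
    rw [show e * of (momPi u) * eᵀ * (e * ((of (dShift u))ᵀ * f)) =
      e * (of (momPi u) * (eᵀ * e) * (of (dShift u))ᵀ * f) by simp only [mul_assoc],
      trace_mul_comm, mul_assoc, hfe, mul_one, mul_assoc]
  rw [h1, ← h2]
  simp only [momPi_frameJet, dShift_frameJet, Finset.mul_sum]
  refine Finset.sum_congr rfl fun i _ => Finset.sum_congr rfl fun j _ => ?_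
  field_simp

end Covariance

/-- On the diagonal the form can be regrouped to match the terms of the density one by one; the
coefficients $\frac{3P+1}4$ and $\frac{P-1}4$ are $1+C_2$ and $C_3$. -/
theorem modelForm_self (L P : ℝ) (x : Jet) : modelForm L P x x =
    (∑ i, ∑ j, momPi x i j * momPi x i j) - 1 / 2 * trPi x ^ 2
      - (∑ a, ∑ b, ∑ c, loweredChristoffel x b a c * loweredChristoffel x c a b)
      + (∑ k, (divMetric x k - 1 / 2 * dTrace x k) * (1 / 2 * dTrace x k))
      + (∑ k, (divMetric x k - dTrace x k) * dLapse x k)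
      + (∑ i, ∑ j, momPi x i j * (2 * dShift x i j))
      + ((3 * P + 1) / 4 * (∑ i, momRho x i * (divMetric x i - 1 / 2 * dTrace x i))
        + (P - 1) / 4 * (∑ i, momRho x i * (1 / 2 * dTrace x i)) - ∑ i, momRho x i * dLapse x i)
      - L / 2 * trPi x * momSigma x + L / 8 * momSigma x ^ 2
      - (3 * P + 1) / 8 * (∑ i, momRho x i * momRho x i) := by
  rw [modelForm, LinearMap.mk₂_apply]
  simp only [loweredChristoffel, divMetric, dTrace, trPi, Fin.sum_univ_three, dMetric_one_zero,
    dMetric_two_zero, dMetric_two_one, momPi_one_zero, momPi_two_zero, momPi_two_one]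
  ring

/-- The members of the two-parameter family. -/
def familyMember (L P : ℝ) : Parameters where
  C₁ := (L - 1) / 2
  C₂ := 3 * (P - 1) / 4
  C₃ := (P - 1) / 4
  C₄ := (L - 1) / 8
  C₅ := 0
  C₆ := 3 * (P - 1) / 8
  C₇ := 0

/-- The conditions are linear and triangular: $\lambda_+^2=1+C_2+C_3$ and $\lambda_-^2=1+2C_1-C_7$.
Uniqueness follows, and every later statement can work with one explicit member. -/
theorem inFamily_iff {C : Parameters} {L P : ℝ} :
    InFamily C ∧ lamMinusSq C = L ∧ lamPlusSq C = P ↔ C = familyMember L P := by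
  simp only [InFamily, lamMinusSq, lamPlusSq, lamVSq, Parameters.ext_iff, familyMember]
  constructor
  · rintro ⟨⟨h1, h2, h3, h4, h5⟩, h6, h7⟩
    refine ⟨?_, ?_, ?_, ?_, ?_, ?_, ?_⟩ <;> linarith
  · rintro ⟨h1, h2, h3, h4, h5, h6, h7⟩
    refine ⟨⟨?_, ?_, ?_, ?_, ?_⟩, ?_, ?_⟩ <;> linarith

/-! ### The density of the family in frame variables. -/

section Density

variable {e f : Matrix (Fin 3) (Fin 3) ℝ} (hfe : f * e = 1) (hef : e * f = 1) {α s : ℝ}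
  (hα : α ≠ 0) (hs : s ≠ 0) {q : Positions} (u : Jet)

theorem sum_raise_mul (hq : invMetric q = f * fᵀ) (v w : Fin 3 → ℝ) :
    ∑ i, (∑ l, invMetric q i l * v l) * w i =
      ∑ a, (∑ i, f i a * v i) * (∑ j, f j a * w j) := by
  rw [← sum_invMetric hq, Finset.sum_comm]
  simp only [Finset.sum_mul, invMetric_comm hq]

theorem admDensity_frame (hq : metric q = eᵀ * e) (hq' : invMetric q = f * fᵀ)
    (hα' : lapse q = α) (hs' : √(detMetric q) = s) :
    admDensity q u = α * s *
      ((∑ i, ∑ j, momPi (frameJet hfe hef hα hs u) i j * momPi (frameJet hfe hef hα hs u) i j)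
        - 1 / 2 * trPi (frameJet hfe hef hα hs u) ^ 2
        - (∑ a, ∑ b, ∑ c, loweredChristoffel (frameJet hfe hef hα hs u) b a c *
          loweredChristoffel (frameJet hfe hef hα hs u) c a b)
        + (∑ k, (divMetric (frameJet hfe hef hα hs u) k
            - 1 / 2 * dTrace (frameJet hfe hef hα hs u) k) *
          (1 / 2 * dTrace (frameJet hfe hef hα hs u) k))
        + (∑ k, (divMetric (frameJet hfe hef hα hs u) k - dTrace (frameJet hfe hef hα hs u) k) *
          dLapse (frameJet hfe hef hα hs u) k)
        + (∑ i, ∑ j, momPi (frameJet hfe hef hα hs u) i j *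
          (2 * dShift (frameJet hfe hef hα hs u) i j)))
      + ∑ k, shift q k * ∑ i, ∑ j, momPi u i j * dMetric u k i j := by
  have hc := invMetric_comm hq'
  have h1 : ∑ i, ∑ j, invMetric q i j * ∑ k, ∑ l, christoffel q u k i j * christoffel q u l k l =
      ∑ k, (divMetric (frameJet hfe hef hα hs u) k - 1 / 2 * dTrace (frameJet hfe hef hα hs u) k) *
        (1 / 2 * dTrace (frameJet hfe hef hα hs u) k) := by
    have h2 : ∑ i, ∑ j, invMetric q i j * ∑ k, ∑ l, christoffel q u k i j * christoffel q u l k l =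
        ∑ k, christoffelTrace q u k * (1 / 2 * covDTrace q u k) := by
      simp only [← sum_christoffel_eq hc, christoffelTrace, Finset.sum_mul, ← Finset.mul_sum]
      rw [Finset.sum_comm' (s := Finset.univ) (t := fun _ => Finset.univ) (t' := Finset.univ)
        (s' := fun _ => Finset.univ) (by simp)]
      simp only [Fin.sum_univ_three, hc 1 0, hc 2 0, hc 2 1]
      ring
    rw [h2]
    simp only [christoffelTrace_eq hc, sum_raise_mul hq']
    refine Finset.sum_congr rfl fun a _ => ?_
    simp only [divMetric_frameJet hfe hef hα hs u _ hq', dTrace_frameJet hfe hef hα hs u _ hq',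
      Fin.sum_univ_three]
    ring
  have h3 : ∑ k, (christoffelTrace q u k - christoffelContr q u k) * dLapse u k =
      α * ∑ k, (divMetric (frameJet hfe hef hα hs u) k - dTrace (frameJet hfe hef hα hs u) k) *
          dLapse (frameJet hfe hef hα hs u) k := by
    have h4 : ∀ k, christoffelTrace q u k - christoffelContr q u k =
        ∑ l, invMetric q k l * (covDivMetric q u l - covDTrace q u l) := by
      intro k
      rw [christoffelTrace_eq hc, christoffelContr_eq hc, ← Finset.sum_sub_distrib]
      refine Finset.sum_congr rfl fun l _ => ?_
      ring
    simp only [h4, sum_raise_mul hq']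
    rw [Finset.mul_sum]
    refine Finset.sum_congr rfl fun a _ => ?_
    simp only [divMetric_frameJet hfe hef hα hs u _ hq', dTrace_frameJet hfe hef hα hs u _ hq',
      dLapse_frameJet, Fin.sum_univ_three]
    field_simp
    ring
  have h5 : ∑ i, ∑ j, momPi u i j * (∑ k, (shift q k * dMetric u k i j +
      metric q k j * dShift u i k + metric q i k * dShift u j k)) =
      (∑ i, ∑ j, momPi u i j * ∑ k, (metric q k j * dShift u i k + metric q i k * dShift u j k))
      + ∑ k, shift q k * ∑ i, ∑ j, momPi u i j * dMetric u k i j := by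
    simp only [Fin.sum_univ_three]
    ring
  rw [admDensity, h5, h3, sum_momPi_mul_dShift hfe hef hα hs u hq, tracePi_eq hfe hef hα hs u hq,
    sum_momPi_mul_momPi hfe hef hα hs u hq, hα', hs']
  simp only [mul_sub, Finset.sum_sub_distrib, h1,
    sum_christoffel_mul_christoffel hfe hef hα hs u hq']
  field_simp
  ring

theorem sum_momRho_mul_raise (hq : invMetric q = f * fᵀ) (v : Fin 3 → ℝ) :
    ∑ i, momRho u i * ∑ l, invMetric q i l * v l =
      s / α * ∑ a, momRho (frameJet hfe hef hα hs u) a * ∑ l, f l a * v l := by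
  simp only [mul_comm (momRho u _), sum_raise_mul hq, Finset.mul_sum (s := Finset.univ)
    (a := s / α), momRho_frameJet]
  refine Finset.sum_congr rfl fun a _ => ?_
  field_simp

theorem grDensity_frame {C : Positions → Parameters} {L P : ℝ} (hC : C q = familyMember L P)
    (hq : metric q = eᵀ * e) (hq' : invMetric q = f * fᵀ)
    (hα' : lapse q = α) (hs' : √(detMetric q) = s) :
    grDensity C q u = α * s * modelForm L P (frameJet hfe hef hα hs u) (frameJet hfe hef hα hs u)
      + advectionForm (shift q) u u := by
  have hc := invMetric_comm hq'
  have h1 : ∑ i, momRho u i * christoffelTrace q u i = s / α *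
      ∑ a, momRho (frameJet hfe hef hα hs u) a * (divMetric (frameJet hfe hef hα hs u) a
        - 1 / 2 * dTrace (frameJet hfe hef hα hs u) a) := by
    simp only [christoffelTrace_eq hc]
    rw [sum_momRho_mul_raise hfe hef hα hs u hq'
      fun l => covDivMetric q u l - 1 / 2 * covDTrace q u l]
    simp only [divMetric_frameJet hfe hef hα hs u _ hq', dTrace_frameJet hfe hef hα hs u _ hq',
      Fin.sum_univ_three]
    ring
  have h2 : ∑ i, momRho u i * christoffelContr q u i = s / α *
      ∑ a, momRho (frameJet hfe hef hα hs u) a * (1 / 2 * dTrace (frameJet hfe hef hα hs u) a) := by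
    simp only [christoffelContr_eq hc]
    rw [sum_momRho_mul_raise hfe hef hα hs u hq'
      fun l => 1 / 2 * covDTrace q u l]
    simp only [dTrace_frameJet hfe hef hα hs u _ hq', Fin.sum_univ_three]
    ring
  have h3 : ∑ i, ∑ j, invMetric q i j * momRho u j * dLapse u i = s *
      ∑ a, momRho (frameJet hfe hef hα hs u) a * dLapse (frameJet hfe hef hα hs u) a := by
    have h4 : ∑ i, ∑ j, invMetric q i j * momRho u j * dLapse u i =
        ∑ i, ∑ j, invMetric q i j * dLapse u i * momRho u j :=
      Finset.sum_congr rfl fun i _ => Finset.sum_congr rfl fun j _ => by ring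
    rw [h4, sum_invMetric hq', Finset.mul_sum]
    refine Finset.sum_congr rfl fun a _ => ?_
    rw [momRho_frameJet, dLapse_frameJet]
    field_simp
  have h4 : ∑ i, ∑ j, momRho u i * momRho u j * invMetric q i j = (s / α) ^ 2 *
      ∑ a, momRho (frameJet hfe hef hα hs u) a * momRho (frameJet hfe hef hα hs u) a := by
    have h5 : ∑ i, ∑ j, momRho u i * momRho u j * invMetric q i j =
        ∑ i, ∑ j, invMetric q i j * momRho u i * momRho u j :=
      Finset.sum_congr rfl fun i _ => Finset.sum_congr rfl fun j _ => by ring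
    rw [h5, sum_invMetric hq', Finset.mul_sum]
    refine Finset.sum_congr rfl fun a _ => ?_
    rw [momRho_frameJet]
    field_simp
  have h6 : ∑ i, gaugeOmega (C q) q u i * momRho u i =
      3 * (P - 1) / 4 * α ^ 2 * (∑ i, momRho u i * christoffelTrace q u i)
      + (P - 1) / 4 * α ^ 2 * (∑ i, momRho u i * christoffelContr q u i)
      - 3 * (P - 1) / 8 * s⁻¹ * α ^ 3 * ∑ i, ∑ j, momRho u i * momRho u j * invMetric q i j := by
    simp only [gaugeOmega, hC, familyMember, hα', hs', Fin.sum_univ_three]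
    ring
  have h7 : momSigma u = s / α * momSigma (frameJet hfe hef hα hs u) := by
    rw [momSigma_frameJet]
    field_simp
  have h8 : advectionForm (shift q) u u = (∑ i, shift q i * momSigma u * dLapse u i)
      + (∑ i, ∑ j, shift q i * momRho u j * dShift u i j)
      + ∑ k, shift q k * ∑ i, ∑ j, momPi u i j * dMetric u k i j := by
    rw [advectionForm_apply]
    simp only [← Finset.sum_add_distrib]
    refine Finset.sum_congr rfl fun i _ => ?_
    simp only [pair, dMetric, dLapse, dShift, momPi, momSigma, momRho, Fin.sum_univ_three]
    ring
  have h9 : gaugeLambda (C q) q u = -((L - 1) / 2) * α ^ 2 * s⁻¹ * tracePi q u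
      + (L - 1) / 8 * α ^ 3 * s⁻¹ * momSigma u := by
    simp only [gaugeLambda, hC, familyMember, hα', hs']
    ring
  rw [grDensity, h6, h9, h8, admDensity_frame hfe hef hα hs u hq hq' hα' hs', ghgDensity, h1, h2,
    h3, h4, hα', hs', tracePi_eq hfe hef hα hs u hq, modelForm_self]
  generalize ∑ i, shift q i * momSigma u * dLapse u i = B₁
  rw [h7]
  field_simp
  ring

end Density

/-! ### Plane waves of the model system with squared speeds $L$ and $P$. -/

section PlaneWaves

/-- The jet of a plane wave along the first axis of the frame. -/
def planeJet (v : Positions) (w : Momenta) : Jet := (Pi.single 0 v, w)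

/-- A perturbation of the lapse. -/
def lapseWave : Jet := planeJet (0, 1, 0) 0

/-- The rate of change of `lapseWave`. -/
def lapseWaveRate : Jet :=
  planeJet (0, 0, fun i => if i = 0 then -1 else 0)
    (⟨fun i j => if i = j ∧ i ≠ 0 then -1 else 0, fun i j => by
      by_cases h : i = j
      · rw [h]
      · simp [h, Ne.symm h]⟩, 0, 0)

/-- A longitudinal perturbation of the shift. -/
def shiftWave : Jet := planeJet (0, 0, fun i => if i = 0 then 1 else 0) 0

/-- The rate of change of `shiftWave`. -/
def shiftWaveRate : Jet :=
  planeJet (⟨fun i j => if i = 0 ∧ j = 0 then 2 else 0, fun i j => by simp [and_comm]⟩, 0, 0) 0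

section

variable (v : Positions) (w : Momenta) (i j k : Fin 3)

@[simp] theorem dMetric_planeJet :
    dMetric (planeJet v w) k i j = if k = 0 then v.1.1 i j else 0 := dMetric_slopeJet v k i j 0
@[simp] theorem dLapse_planeJet : dLapse (planeJet v w) k = if k = 0 then v.2.1 else 0 :=
  dLapse_slopeJet v k 0
@[simp] theorem dShift_planeJet : dShift (planeJet v w) k i = if k = 0 then v.2.2 i else 0 :=
  dShift_slopeJet v k i 0
@[simp] theorem momPi_planeJet : momPi (planeJet v w) i j = w.1.1 i j := rfl
@[simp] theorem momSigma_planeJet : momSigma (planeJet v w) = w.2.1 := rfl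
@[simp] theorem momRho_planeJet : momRho (planeJet v w) i = w.2.2 i := rfl
@[simp] theorem dMetric_zero : dMetric 0 k i j = 0 := rfl
@[simp] theorem dLapse_zero : dLapse 0 k = 0 := rfl
@[simp] theorem dShift_zero : dShift 0 k i = 0 := rfl
@[simp] theorem momPi_zero : momPi 0 i j = 0 := rfl
@[simp] theorem momSigma_zero : momSigma 0 = 0 := rfl
@[simp] theorem momRho_zero : momRho 0 i = 0 := rfl

end

variable (L P : ℝ)

theorem modelRate_lapseWave : modelRate L P (Pi.single 0 lapseWave) = lapseWaveRate := by
  refine jet_ext (fun k i j => ?_) (fun k => ?_) (fun k i => ?_) (fun i j => ?_) ?_ (fun i => ?_)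
  · rw [modelRate_dMetric]
    fin_cases k <;> fin_cases i <;> fin_cases j <;>
      simp [lapseWave, lapseWaveRate, trPi]
  · rw [modelRate_dLapse]
    fin_cases k <;> simp [lapseWave, lapseWaveRate, trPi]
  · rw [modelRate_dShift]
    fin_cases k <;> fin_cases i <;>
      simp [lapseWave, lapseWaveRate, divMetric, dTrace]
  · rw [modelRate_momPi]
    fin_cases i <;> fin_cases j <;>
      simp [lapseWave, lapseWaveRate, modelStress, divMetric, dTrace, Fin.sum_univ_three]
    norm_num
  · rw [modelRate_momSigma]
    simp [lapseWave, lapseWaveRate, divMetric, dTrace, Fin.sum_univ_three]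
  · rw [modelRate_momRho]
    fin_cases i <;> simp [lapseWave, lapseWaveRate, Fin.sum_univ_three]

theorem modelRate_lapseWaveRate : modelRate L P (Pi.single 0 lapseWaveRate) = L • lapseWave := by
  refine jet_ext (fun k i j => ?_) (fun k => ?_) (fun k i => ?_) (fun i j => ?_) ?_ (fun i => ?_)
  · rw [modelRate_dMetric]
    fin_cases k <;> fin_cases i <;> fin_cases j <;>
      simp [lapseWaveRate, lapseWave, trPi, Fin.sum_univ_three] <;> norm_num
  · rw [modelRate_dLapse]
    fin_cases k <;> simp [lapseWaveRate, lapseWave, trPi, Fin.sum_univ_three]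
    ring
  · rw [modelRate_dShift]
    fin_cases k <;> fin_cases i <;>
      simp [lapseWaveRate, lapseWave, divMetric, dTrace]
  · rw [modelRate_momPi]
    fin_cases i <;> fin_cases j <;>
      simp [lapseWaveRate, lapseWave, modelStress, divMetric, dTrace, Fin.sum_univ_three]
  · rw [modelRate_momSigma]
    simp [lapseWaveRate, lapseWave, divMetric, dTrace, Fin.sum_univ_three]
  · rw [modelRate_momRho]
    fin_cases i <;> simp [lapseWaveRate, lapseWave, Fin.sum_univ_three]

theorem modelRate_shiftWave : modelRate L P (Pi.single 0 shiftWave) = shiftWaveRate := by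
  refine jet_ext (fun k i j => ?_) (fun k => ?_) (fun k i => ?_) (fun i j => ?_) ?_ (fun i => ?_)
  · rw [modelRate_dMetric]
    fin_cases k <;> fin_cases i <;> fin_cases j <;>
      simp [shiftWave, shiftWaveRate, trPi]
    norm_num
  · rw [modelRate_dLapse]
    fin_cases k <;> simp [shiftWave, shiftWaveRate, trPi]
  · rw [modelRate_dShift]
    fin_cases k <;> fin_cases i <;>
      simp [shiftWave, shiftWaveRate, divMetric, dTrace]
  · rw [modelRate_momPi]
    fin_cases i <;> fin_cases j <;>
      simp [shiftWave, shiftWaveRate, modelStress, divMetric, dTrace, Fin.sum_univ_three]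
  · rw [modelRate_momSigma]
    simp [shiftWave, shiftWaveRate, divMetric, dTrace, Fin.sum_univ_three]
  · rw [modelRate_momRho]
    fin_cases i <;> simp [shiftWave, shiftWaveRate, Fin.sum_univ_three]

theorem modelRate_shiftWaveRate : modelRate L P (Pi.single 0 shiftWaveRate) = P • shiftWave := by
  refine jet_ext (fun k i j => ?_) (fun k => ?_) (fun k i => ?_) (fun i j => ?_) ?_ (fun i => ?_)
  · rw [modelRate_dMetric]
    fin_cases k <;> fin_cases i <;> fin_cases j <;>
      simp [shiftWaveRate, shiftWave, trPi]
  · rw [modelRate_dLapse]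
    fin_cases k <;> simp [shiftWaveRate, shiftWave, trPi]
  · rw [modelRate_dShift]
    fin_cases k <;> fin_cases i <;>
      simp [shiftWaveRate, shiftWave, divMetric, dTrace]
    ring
  · rw [modelRate_momPi]
    fin_cases i <;> fin_cases j <;>
      simp [shiftWaveRate, shiftWave, modelStress, divMetric, dTrace, Fin.sum_univ_three]
    norm_num
  · rw [modelRate_momSigma]
    simp [shiftWaveRate, shiftWave, divMetric, dTrace, Fin.sum_univ_three]
  · rw [modelRate_momRho]
    fin_cases i <;> simp [shiftWaveRate, shiftWave, Fin.sum_univ_three]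

end PlaneWaves

/-! ### Necessity of positive squared speeds. -/

section Necessity

variable {e f : Matrix (Fin 3) (Fin 3) ℝ} {φ : Positions ≃ₗ[ℝ] Positions}
  {ψ : Momenta ≃ₗ[ℝ] Momenta}

/-- In a symmetric hyperbolic system the squares of the speeds of plane waves are positive. -/
theorem pos_of_planeWave {𝓗 : Density} {q : Positions} {u : Jet} {R₀ : (Fin 3 → Jet) → Jet}
    {α : ℝ} {β : Fin 3 → ℝ} (hfe : f * e = 1) (hef : e * f = 1) (hα : 0 < α)
    (hR : ∀ U, IsCurlFree U → frameMap f φ ψ (rate (hessian 𝓗 q u) U) =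
      α • R₀ (frameDerivative f φ ψ U) + ∑ i, β i • frameMap f φ ψ (U i))
    (h : (canonicalSystem 𝓗 q u).IsSymmetricHyperbolic) {v₀ v₁ : Positions} {w₀ w₁ : Momenta}
    {c : ℝ} (h₀ : R₀ (Pi.single 0 (planeJet v₀ w₀)) = planeJet v₁ w₁)
    (h₁ : R₀ (Pi.single 0 (planeJet v₁ w₁)) = c • planeJet v₀ w₀) (hne : planeJet v₁ w₁ ≠ 0) :
    0 < c := by
  obtain ⟨𝔸, h𝔸, H, hsymm, hpos, hH⟩ := h
  rw [isFirstOrderReduction_canonicalSystem] at h𝔸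
  let Φ := frameMap f φ ψ
  have hΦ : Function.Injective Φ := frameMap_injective hfe
  -- The slopes are proportional to the covector $n_i=e_{0i}$ dual to the first frame vector. The
  -- derivative $n_p$ times such a jet is curl-free, so auxiliary constraint terms in the reduction
  -- cannot contribute.
  let wave : Positions → Momenta → Jet := fun v w => (fun i => e 0 i • φ.symm v, ψ.symm w)
  have hdelta : ∀ a, ∑ i, f i a * e 0 i = if a = 0 then 1 else 0 := by
    intro a
    have h2 := congrFun (congrFun hef 0) a
    rw [Matrix.mul_apply, Matrix.one_apply] at h2
    simp only [mul_comm (f _ _), h2, eq_comm]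
  have hwave : ∀ v w, Φ (wave v w) = planeJet v w := by
    intro v w
    refine Prod.ext (funext fun a => ?_) ?_
    · rw [frameMap_fst]
      simp only [wave, map_smul, LinearEquiv.apply_symm_apply, smul_smul, ← Finset.sum_smul, hdelta,
        planeJet, Pi.single_apply, ite_smul, one_smul, zero_smul]
    · rw [frameMap_snd]
      simp [wave, planeJet]
  let 𝒜 : Jet →ₗ[ℝ] Jet := ∑ i, e 0 i • 𝔸 i
  have h𝒜 : ∀ x y, H x (𝒜 y) = H (𝒜 x) y := by
    intro x y
    simp only [𝒜, LinearMap.sum_apply, LinearMap.smul_apply, map_sum, map_smul, hH]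
  have hrate : ∀ v w, Φ (𝒜 (wave v w)) =
      α • R₀ (Pi.single 0 (planeJet v w)) + (∑ i, β i * e 0 i) • planeJet v w := by
    intro v w
    have h2 : 𝒜 (wave v w) = rate (hessian 𝓗 q u) fun i => e 0 i • wave v w := by
      rw [← h𝔸]
      · simp [𝒜]
      · intro p i
        simp only [wave, Prod.smul_fst, Pi.smul_apply, smul_smul, mul_comm]
    have h3 : frameDerivative f φ ψ (fun i => e 0 i • wave v w) = Pi.single 0 (planeJet v w) := by
      funext a
      rw [← hwave, frameDerivative]
      simp only [map_smul, smul_smul, ← Finset.sum_smul, hdelta, Pi.single_apply, ite_smul,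
        one_smul, zero_smul]
      rfl
    rw [h2, hR, h3]
    · simp only [map_smul, smul_smul, ← Finset.sum_smul]
      rw [← hwave]
    · intro p i
      simp only [wave, Prod.smul_fst, Pi.smul_apply, smul_smul, mul_comm]
  have e₀ : 𝒜 (wave v₀ w₀) = α • wave v₁ w₁ + (∑ i, β i * e 0 i) • wave v₀ w₀ := by
    apply hΦ
    rw [hrate, h₀, map_add, map_smul, map_smul, hwave, hwave]
  have e₁ : 𝒜 (wave v₁ w₁) = (α * c) • wave v₀ w₀ + (∑ i, β i * e 0 i) • wave v₁ w₁ := by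
    apply hΦ
    rw [hrate, h₁, map_add, map_smul, map_smul, hwave, hwave, smul_smul]
  -- The advection terms cancel by symmetry of $H$, leaving $\alpha H(w_1,w_1)=\alpha c\,H(w_0,w_0)$
  -- for the two waves $w_0,w_1$. The left side is positive, which forces $c>0$.
  have key := h𝒜 (wave v₁ w₁) (wave v₀ w₀)
  rw [e₀, e₁] at key
  simp only [map_add, map_smul, LinearMap.add_apply, LinearMap.smul_apply, smul_eq_mul] at key
  have hw₁ : wave v₁ w₁ ≠ 0 := fun h0 => hne (by rw [← hwave, h0, map_zero])
  have hp₁ := hpos _ hw₁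
  have hp₀ : 0 ≤ H (wave v₀ w₀) (wave v₀ w₀) := by
    by_cases h0 : wave v₀ w₀ = 0
    · simp [h0]
    · exact (hpos _ h0).le
  by_contra hc
  have h5 : H (wave v₁ w₁) (wave v₁ w₁) = c * H (wave v₀ w₀) (wave v₀ w₀) := by
    have : α * (H (wave v₁ w₁) (wave v₁ w₁) - c * H (wave v₀ w₀) (wave v₀ w₀)) = 0 := by
      linarith
    rcases mul_eq_zero.1 this with h6 | h6
    · exact absurd h6 hα.ne'
    · linarith
  have : c * H (wave v₀ w₀) (wave v₀ w₀) ≤ 0 := mul_nonpos_of_nonpos_of_nonneg (not_lt.1 hc) hp₀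
  linarith

end Necessity

/-! ### Hyperbolicity and gauge conditions of the family on an arbitrary background. -/

theorem sqrt_detMetric_pos {q : Positions} (hq : Admissible q) : 0 < √(detMetric q) :=
  Real.sqrt_pos.2 hq.1.det_pos

theorem exists_frame_density {C : Positions → Parameters} {q : Positions} {L P : ℝ}
    (hq : Admissible q) (hC : C q = familyMember L P) :
    ∃ (e f : Matrix (Fin 3) (Fin 3) ℝ) (hfe : f * e = 1) (hef : e * f = 1),
      metric q = eᵀ * e ∧ invMetric q = f * fᵀ ∧ ∀ u, grDensity C q u =
        ((lapse q * √(detMetric q)) • (modelForm L P).compl₁₂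
          (frameJet hfe hef hq.2.ne' (sqrt_detMetric_pos hq).ne')
          (frameJet hfe hef hq.2.ne' (sqrt_detMetric_pos hq).ne')
          + advectionForm (shift q)) u u := by
  obtain ⟨e, f, hfe, hef, he, hf⟩ := exists_frame hq.1
  refine ⟨e, f, hfe, hef, he, hf, fun u => ?_⟩
  rw [grDensity_frame hfe hef hq.2.ne' (sqrt_detMetric_pos hq).ne' u hC he hf rfl rfl]
  rfl

theorem isSymmetricHyperbolic_iff {C : Positions → Parameters} {q : Positions} {L P : ℝ} (u : Jet)
    (hq : Admissible q) (hC : C q = familyMember L P) :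
    (canonicalSystem (grDensity C) q u).IsSymmetricHyperbolic ↔ 0 < L ∧ 0 < P := by
  obtain ⟨e, f, hfe, hef, -, -, hdens⟩ := exists_frame_density hq hC
  have hR : ∀ U, IsCurlFree U → _ := fun U hU => frameMap_rate rfl
    (pair_frame hfe hef hq.2.ne' (sqrt_detMetric_pos hq).ne') hU
      (b₀ := modelForm L P) (α := lapse q) (β := shift q) (f := f)
  have hh := hessian_eq_polarization _ hdens u
  simp only [frameJet] at hh
  rw [← hh] at hR
  constructor
  · intro h
    refine ⟨pos_of_planeWave hfe hef hq.2 hR h (modelRate_lapseWave L P)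
      (modelRate_lapseWaveRate L P) fun h0 => ?_, pos_of_planeWave hfe hef hq.2 hR h
      (modelRate_shiftWave L P) (modelRate_shiftWaveRate L P) fun h0 => ?_⟩
    · have := congrArg (fun x => dShift x 0 0) h0
      simp at this
    · have := congrArg (fun x => dMetric x 0 0 0) h0
      simp at this
  · rintro ⟨hL, hP⟩
    exact isSymmetricHyperbolic_of_hasSymmetrizer
      (hasSymmetrizer_of_frameMap hfe hR (hasSymmetrizer_modelRate hL hP))

/-- The evolution equation of the lapse in the two-parameter family. -/
theorem lapse_positionRate {C : Positions → Parameters} {q : Positions} {L P : ℝ} (u : Jet)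
    (hq : Admissible q) (hC : C q = familyMember L P) :
    lapse (positionRate (grDensity C) q u) =
      L / 4 * lapse q ^ 3 * momSigma u / √(detMetric q)
        - L / 2 * lapse q ^ 2 * tracePi q u / √(detMetric q) + ∑ i, shift q i * dLapse u i := by
  obtain ⟨e, f, hfe, hef, he, -, hdens⟩ := exists_frame_density hq hC
  have hα := hq.2.ne'
  have hs := (sqrt_detMetric_pos hq).ne'
  rw [positionRate, fderiv_eq_polarization _ hdens]
  simp only [frameJet]
  rw [momentumGradient_frame rfl (pair_frame hfe hef hα hs), momentumGradient_modelForm,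
    tracePi_eq hfe hef hα hs u he]
  have h1 : momSigma u = √(detMetric q) / lapse q * momSigma (frameJet hfe hef hα hs u) := by
    rw [momSigma_frameJet]
    field_simp
  -- One factor $\alpha$ comes from the rate and the other from undoing the scaling of the lapse.
  have h2 : ∀ v : Positions, lapse q * ((framePositions hfe hef hα).symm v).2.1 =
      lapse q ^ 2 * v.2.1 := by
    intro v
    have h3 := framePositions_lapse hfe hef hα ((framePositions hfe hef hα).symm v)
    rw [LinearEquiv.apply_symm_apply] at h3
    rw [h3]
    field_simp
  change lapse q * ((framePositions hfe hef hα).symm _).2.1 + (∑ i, shift q i • u.1 i).2.1 = _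
  rw [h2, h1]
  simp only [Prod.snd_sum, Prod.fst_sum]
  change lapse q ^ 2 * (L / 4 * momSigma (frameJet hfe hef hα hs u)
    - L / 2 * trPi (frameJet hfe hef hα hs u)) + ∑ i, shift q i * dLapse u i = _
  field_simp

/-- The evolution equation of the shift in the two-parameter family. -/
theorem shift_positionRate {C : Positions → Parameters} {q : Positions} {L P : ℝ} (u : Jet)
    (hq : Admissible q) (hC : C q = familyMember L P) (i : Fin 3) :
    shift (positionRate (grDensity C) q u) i =
      (3 * P + 1) / 4 * lapse q ^ 2 * christoffelTrace q u i
        + (P - 1) / 4 * lapse q ^ 2 * christoffelContr q u i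
        - (3 * P + 1) / 4 * lapse q ^ 3 / √(detMetric q) * (∑ j, invMetric q i j * momRho u j)
        - lapse q * (∑ j, invMetric q i j * dLapse u j) + ∑ j, shift q j * dShift u j i := by
  obtain ⟨e, f, hfe, hef, -, hf, hdens⟩ := exists_frame_density hq hC
  have hα := hq.2.ne'
  have hs := (sqrt_detMetric_pos hq).ne'
  have hc := invMetric_comm hf
  rw [positionRate, fderiv_eq_polarization _ hdens]
  simp only [frameJet]
  rw [momentumGradient_frame rfl (pair_frame hfe hef hα hs), momentumGradient_modelForm]
  have h2 : ∀ v : Positions, lapse q * ((framePositions hfe hef hα).symm v).2.2 i =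
      lapse q ^ 2 * ∑ a, f i a * v.2.2 a := by
    intro v
    have h3 := framePositions_shift hfe hef hα ((framePositions hfe hef hα).symm v)
    rw [LinearEquiv.apply_symm_apply] at h3
    generalize (framePositions hfe hef hα).symm v = w at h3
    have h4 : ∑ a, f i a * ∑ j, e a j * w.2.2 j = w.2.2 i := by
      change (f *ᵥ (e *ᵥ w.2.2)) i = _
      rw [mulVec_mulVec, hfe, one_mulVec]
    simp only [h3, mul_left_comm (f i _), ← Finset.mul_sum, h4]
    field_simp
  have h5 : ∀ v : Fin 3 → ℝ, ∑ j, invMetric q i j * v j = ∑ a, f i a * ∑ l, f l a * v l := by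
    intro v
    simp only [hf, Matrix.mul_apply, transpose_apply, Fin.sum_univ_three]
    ring
  change lapse q * ((framePositions hfe hef hα).symm _).2.2 i + (∑ j, shift q j • u.1 j).2.2 i = _
  rw [h2, christoffelTrace_eq hc, christoffelContr_eq hc, h5, h5, h5, h5]
  simp only [Prod.snd_sum, Finset.sum_apply]
  change lapse q ^ 2 * (∑ a, f i a * ((3 * P + 1) / 4 * (divMetric (frameJet hfe hef hα hs u) a
    - momRho (frameJet hfe hef hα hs u) a) - (P + 1) / 4 * dTrace (frameJet hfe hef hα hs u) a
    - dLapse (frameJet hfe hef hα hs u) a)) + ∑ j, shift q j * dShift u j i = _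
  rw [add_left_inj]
  simp only [divMetric_frameJet hfe hef hα hs u _ hf, dTrace_frameJet hfe hef hα hs u _ hf,
    momRho_frameJet, dLapse_frameJet, Fin.sum_univ_three]
  field_simp
  ring

/-- The factor 2 is $\gamma_{ij}\gamma^{ij}-1=3-1$. -/
theorem tracePi_of_isZ4Variables {q : Positions} {u : Jet} {K : Fin 3 → Fin 3 → ℝ} {Θ : ℝ}
    {Z : Fin 3 → ℝ} (hq : Admissible q) (h : IsZ4Variables q u K Θ Z) :
    tracePi q u = 2 * √(detMetric q) * ∑ i, ∑ j, invMetric q i j * K i j := by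
  obtain ⟨e, f, hfe, hef, he, hf⟩ := exists_frame hq.1
  have hG : (invMetric q)ᵀ = invMetric q := by rw [hf, transpose_mul, transpose_transpose]
  have hmul : metric q * invMetric q = 1 := by
    rw [he, hf, mul_assoc, ← mul_assoc e, hef, one_mul, ← transpose_mul, hfe, transpose_one]
  have h1 : ∑ i, ∑ j, metric q i j * invMetric q i j = 3 := by
    rw [sum_mul_eq_trace, hG, hmul, trace_one]
    simp
  have h2 : ∑ i, ∑ j, metric q i j * (∑ k, ∑ l, invMetric q i k * invMetric q j l * K k l) =
      ∑ i, ∑ j, invMetric q i j * K i j := by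
    have h3 : ∀ i j, ∑ k, ∑ l, invMetric q i k * invMetric q j l * K k l =
        (invMetric q * of K * (invMetric q)ᵀ) i j := by
      intro i j
      simp only [Matrix.mul_apply, transpose_apply, of_apply, Fin.sum_univ_three]
      ring
    simp only [h3]
    rw [sum_mul_eq_trace, show (∑ i, ∑ j, invMetric q i j * K i j) =
      ∑ i, ∑ j, invMetric q i j * of K i j from rfl, sum_mul_eq_trace, transpose_mul, transpose_mul,
      transpose_transpose, hG, ← mul_assoc, hmul, one_mul, trace_mul_comm]
  have h4 : tracePi q u = √(detMetric q) * ((∑ k, ∑ l, invMetric q k l * K k l) *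
      (∑ i, ∑ j, metric q i j * invMetric q i j) -
      ∑ i, ∑ j, metric q i j * (∑ k, ∑ l, invMetric q i k * invMetric q j l * K k l)) := by
    simp only [tracePi, h.1, Finset.mul_sum (s := Finset.univ) (a := √(detMetric q)),
      ← Finset.sum_sub_distrib, Finset.mul_sum (s := Finset.univ)
      (a := ∑ k, ∑ l, invMetric q k l * K k l)]
    refine Finset.sum_congr rfl fun i _ => Finset.sum_congr rfl fun j _ => ?_
    ring
  rw [h4, h1, h2]
  ring

end HamiltonianGR

end

theorem mainTheorem7 :
    -- the family has exactly one member for each pair of values of `λ₋²` and `λ₊²`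
    (∀ a b : ℝ, ∃! C : Parameters, InFamily C ∧
      lamMinusSq C = a ∧ lamPlusSq C = b) ∧
    -- its members with `λ₋² > 0` and `λ₊² > 0` are symmetric hyperbolic
    (∀ (C : Positions → Parameters) (q : Positions)
      (u : Jet), Admissible q → InFamily (C q) →
      0 < lamMinusSq (C q) → 0 < lamPlusSq (C q) →
      (canonicalSystem (grDensity C) q u).IsSymmetricHyperbolic) ∧
    -- the modified puncture gauge
    (∀ (μL μS : Positions → ℝ)
      (C : Positions → Parameters),
      (∀ q, Admissible q → InFamily (C q) ∧
        lamMinusSq (C q) = μL q ∧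
        lamPlusSq (C q) =
          4 * μS q * detMetric q ^ (1 / 3 : ℝ) / (3 * lapse q ^ 2)
            - 1 / 3) →
      ∀ (q : Positions) (u : Jet), Admissible q →
        ((canonicalSystem (grDensity C) q u).IsSymmetricHyperbolic ↔
          0 < μL q ∧
            lapse q ^ 2 < 4 * detMetric q ^ (1 / 3 : ℝ) * μS q) ∧
        ∀ (K : Fin 3 → Fin 3 → ℝ) (Θ : ℝ) (Z : Fin 3 → ℝ),
          IsZ4Variables q u K Θ Z →
          lapse (positionRate (grDensity C) q u) =
            (∑ i, shift q i * dLapse u i)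
              - μL q * lapse q ^ 2 *
                (∑ i, ∑ j, invMetric q i j * K i j)
              + 1 / 2 * μL q * lapse q ^ 2 * Θ ∧
          ∀ i, shift
              (positionRate (grDensity C) q u) i =
            (∑ j, shift q j * dShift u j i)
              + μS q * detMetric q ^ (1 / 3 : ℝ) *
                christoffelTrace q u i
              + 1 / 3 * (μS q * detMetric q ^ (1 / 3 : ℝ)
                  - lapse q ^ 2) * christoffelContr q u i
              + 2 * μS q * detMetric q ^ (1 / 3 : ℝ) *
                (∑ j, invMetric q i j * Z j)
              - lapse q *
                (∑ j, invMetric q i j * dLapse u j)) := by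
  refine ⟨fun a b => ?_, fun C q u hq hC hL hP => ?_, fun μL μS C hC q u hq => ?_⟩
  · simp only [inFamily_iff]
    exact ⟨_, rfl, fun _ h => h⟩
  · exact (isSymmetricHyperbolic_iff u hq (inFamily_iff.1 ⟨hC, rfl, rfl⟩)).2 ⟨hL, hP⟩
  · have hα := hq.2
    have hs := sqrt_detMetric_pos hq
    have hC' := inFamily_iff.1 (hC q hq)
    refine ⟨?_, fun K Θ Z hZ => ⟨?_, fun i => ?_⟩⟩
    · rw [isSymmetricHyperbolic_iff u hq hC']
      refine and_congr_right fun _ => ?_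
      have h1 : 4 * μS q * detMetric q ^ (1 / 3 : ℝ) / (3 * lapse q ^ 2) - 1 / 3 =
          (4 * detMetric q ^ (1 / 3 : ℝ) * μS q - lapse q ^ 2) / (3 * lapse q ^ 2) := by
        field_simp
      rw [h1, div_pos_iff_of_pos_right (by positivity), sub_pos]
    · rw [lapse_positionRate u hq hC', tracePi_of_isZ4Variables hq hZ, hZ.2.1]
      field_simp
      ring
    · have hρ : ∀ j, momRho u j = -(2 * √(detMetric q) / lapse q) * Z j := by
        intro j
        rw [hZ.2.2 j]
        field_simp
      -- The prescribed $P=\lambda_+^2$ gives $\frac{3P+1}4\alpha^2=\mu_S\gamma^{1/3}$ and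
      -- $\frac{P-1}4\alpha^2=\frac13(\mu_S\gamma^{1/3}-\alpha^2)$.
      rw [shift_positionRate u hq hC' i]
      simp only [hρ, mul_left_comm _ (-(2 * √(detMetric q) / lapse q)), ← Finset.mul_sum]
      field_simp
      ring
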